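/- Graphs are finite and loopless. A connected graph with at least two vertices is matching covered if each of its edges lies in a perfect matching. An edge cut $\partial(X)$ is tight if every perfect matching contains exactly one edge of it, and trivial if $|X|=1$ or $|V\setminus X|=1$. A brick is a nonbipartite matching covered graph without nontrivial tight cuts. A brick is extremal if its number of perfect matchings equals the dimension (rank) of the lattice spanned over $\mathbb{Z}$ by the incidence vectors of its perfect matchings. For $t\ge 1$ let $G_t$ be the graph formed by $t+1$ disjoint paths $u_s^1u_s^2u_s^3u_s^4$ ($0\le s\le t$), a further vertex $u$, and the edges $u_s^1u_{s+1}^1$, $u_s^4u_{s+1}^3$ ($0\le s\le t-1$), $uu_t^1$, $uu_t^4$. Let $S=\{u_0^1,u_0^3,u\}\cup\{u_s^2,u_s^4:0\le s\le t\}$, $S_1=S\setminus\{u_t^2,u_t^4,u\}$, $S_2=S\setminus\{u_t^4,u\}$, $S_3=S\setminus\{u\}$, $S_4=S$. Let $G'_t$ be obtained from $G_t$ by adding a new vertex $u'$ joined to every vertex of $S$. A triangle-insertion at a vertex $v$ of degree $3$ replaces $v$ by a triangle, each of the three edges formerly at $v$ becoming incident with a different vertex of the triangle. Theorem. Let $n\ge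 18$ be even and write $n=i+8(t+1)$ with integers $t\geq 1$ and $0<i\le 8$ (this is possible in exactly one way, and $i$ is even). Then every vertex of $S_{i/2}$ has degree $3$ in $G'_t$, and the graph $G''_n$ obtained from $G'_t$ by triangle-insertions at all vertices of $S_{i/2}$ has $n$ vertices and is an extremal brick. The number of perfect matchings of $G''_n$ is $$|E(G''_n)|-|V(G''_n)|+1=\left\lceil \tfrac{5n}{8}\right\rceil=\frac{5n+8-i}{8}.$$ Consequently the Lucchesi–Murty conjecture fails, even for bricks without multiple edges: there is no positive integer $N$ such that for every $n\ge N$ every brick without multiple edges on $n$ vertices has at least $n-1$ perfect matchings. -/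

import Mathlib

namespace ExtremalBrick

section General

variable {V : Type*}

/-- The number of perfect matchings of `G` (meant for finite graphs). -/
noncomputable def numPM (G : SimpleGraph V) : ℕ :=
  Nat.card {M : G.Subgraph // M.IsPerfectMatching}

/-- A connected nontrivial graph is matching covered if each edge lies in a perfect matching. -/
def IsMatchingCovered (G : SimpleGraph V) : Prop :=
  Nontrivial V ∧ G.Connected ∧
    ∀ e ∈ G.edgeSet, ∃ M : G.Subgraph, M.IsPerfectMatching ∧ e ∈ M.edgeSet

/-- The edge cut of `X`: all edges with one end in `X` and the other outside `X`. -/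
def edgeCut (G : SimpleGraph V) (X : Set V) : Set (Sym2 V) :=
  {e | e ∈ G.edgeSet ∧ ∃ v ∈ X, ∃ w ∉ X, e = s(v, w)}

/-- The cut of `X` is tight if every perfect matching has exactly one edge in it. -/
def IsTightCut (G : SimpleGraph V) (X : Set V) : Prop :=
  ∀ M : G.Subgraph, M.IsPerfectMatching → (M.edgeSet ∩ edgeCut G X).ncard = 1

/-- A brick: a nonbipartite matching covered graph all of whose tight cuts are trivial. -/
def IsBrick (G : SimpleGraph V) : Prop :=
  IsMatchingCovered G ∧ ¬ G.IsBipartite ∧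
    ∀ X : Set V, IsTightCut G X → X.ncard = 1 ∨ Xᶜ.ncard = 1

/-- The incidence vector, indexed by the edges of `G`, of the edge set of `M`. -/
noncomputable def incidenceVector (G : SimpleGraph V) (M : G.Subgraph) : G.edgeSet → ℤ :=
  fun e => M.edgeSet.indicator 1 (e : Sym2 V)

/-- The lattice (all integer combinations) spanned by the incidence vectors of the
perfect matchings of `G`. -/
noncomputable def matchingLattice (G : SimpleGraph V) : Submodule ℤ (G.edgeSet → ℤ) :=
  Submodule.span ℤ {x | ∃ M : G.Subgraph, M.IsPerfectMatching ∧ x = incidenceVector G M}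

/-- A brick is extremal if its number of perfect matchings is the dimension of the lattice
spanned by their incidence vectors. -/
def IsExtremalBrick (G : SimpleGraph V) : Prop :=
  IsBrick G ∧ numPM G = Module.finrank ℤ (matchingLattice G)

/-- The graph obtained from `G` by adding a new vertex `none`, joined to the vertices in `S`. -/
def addVertex (G : SimpleGraph V) (S : Set V) : SimpleGraph (Option V) where
  Adj
    | some v, some w => G.Adj v w
    | some v, none => v ∈ S
    | none, some w => w ∈ S
    | none, none => False
  symm := ⟨by
    rintro (_ | v) (_ | w) h
    · exact h
    · exact h
    · exact h
    · exact SimpleGraph.Adj.symm h⟩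
  loopless := ⟨by
    rintro (_ | v) h
    · exact h
    · exact G.loopless.irrefl v h⟩

/-- Vertices after the triangle-insertions at the vertices of `T`: the vertices outside `T`, and,
for each `v ∈ T`, one corner `(v, w)` for each edge `vw` at `v`. When `v` has degree three there
are three corners. -/
abbrev InsertionVertex (G : SimpleGraph V) (T : Set V) : Type _ :=
  {v : V // v ∉ T} ⊕ {d : G.Dart // d.fst ∈ T}

/-- The graph obtained from `G` by the triangle-insertions at the vertices of `T`, which are meant
to have degree three. Each `v ∈ T` is replaced by a triangle on its three corners, and each of the
three edges `vw` that were incident with `v` becomes incident with the corner `(v, w)`. This is the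
result of splicing `G` at each `v ∈ T` with a copy of the complete graph on four vertices. -/
def triangleInsertion (G : SimpleGraph V) (T : Set V) : SimpleGraph (InsertionVertex G T) where
  Adj
    | .inl v, .inl w => G.Adj v.1 w.1
    | .inl v, .inr e => e.1.snd = v.1
    | .inr d, .inl w => d.1.snd = w.1
    | .inr d, .inr e => (d.1.fst = e.1.fst ∧ d ≠ e) ∨ e.1 = d.1.symm
  symm := ⟨by
    rintro (v | d) (w | e) h
    · exact SimpleGraph.Adj.symm h
    · exact h
    · exact h
    · rcases h with ⟨h, hne⟩ | h
      · exact Or.inl ⟨h.symm, hne.symm⟩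
      · exact Or.inr (by rw [h, SimpleGraph.Dart.symm_symm])⟩
  loopless := ⟨by
    rintro (v | d) h
    · exact G.loopless.irrefl _ h
    · rcases h with ⟨-, hne⟩ | h
      · exact hne rfl
      · exact SimpleGraph.Dart.symm_ne d.1 h.symm⟩

end General

/-- The vertices of `G_t`: `some (s, j)` is the vertex of the `s`-th path (`0 ≤ s ≤ t`) usually
written with lower index `s` and upper index `j + 1` (`0 ≤ j ≤ 3`), and `none` is `u`. -/
abbrev PathVertex (t : ℕ) : Type := Option (Fin (t + 1) × Fin 4)

/-- The edges of `G_t`, each in one direction. -/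
def pathRel (t : ℕ) : PathVertex t → PathVertex t → Prop
  | some (s, j), some (s', j') =>
      (s' = s ∧ (j' : ℕ) = j + 1) ∨
      ((s' : ℕ) = s + 1 ∧ ((j = 0 ∧ j' = 0) ∨ (j = 3 ∧ j' = 2)))
  | none, some (s, j) => s = Fin.last t ∧ (j = 0 ∨ j = 3)
  | _, none => False

/-- The graph `G_t`. -/
def pathGraph (t : ℕ) : SimpleGraph (PathVertex t) := SimpleGraph.fromRel (pathRel t)

/-- The set `S` of vertices of `G_t`. -/
def S (t : ℕ) : Set (PathVertex t) :=
  {some (0, 0), some (0, 2), none} ∪ {v | ∃ s : Fin (t + 1), v = some (s, 1) ∨ v = some (s, 3)}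

/-- The sets `S_1`, `S_2`, `S_3`, `S_4` (only the indices `1, 2, 3, 4` are meaningful). -/
def Ssub (t : ℕ) : ℕ → Set (PathVertex t)
  | 1 => S t \ {some (Fin.last t, 1), some (Fin.last t, 3), none}
  | 2 => S t \ {some (Fin.last t, 3), none}
  | 3 => S t \ {none}
  | _ => S t

/-- The graph `G'_t`: add to `G_t` a new vertex `u'` (here `none`) joined to all of `S`. -/
def primeGraph (t : ℕ) : SimpleGraph (Option (PathVertex t)) := addVertex (pathGraph t) (S t)

/-- The set `S_k`, as a set of vertices of `G'_t`. -/
def insertionSet (t k : ℕ) : Set (Option (PathVertex t)) := some '' Ssub t k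

/-- The vertex type of the graph obtained from `G'_t` by triangle-insertions at `S_k`. -/
abbrev DoublePrimeVertex (t k : ℕ) : Type :=
  InsertionVertex (primeGraph t) (insertionSet t k)

/-- The graph obtained from `G'_t` by triangle-insertions at `S_k`; it is `G''_n`
for `n = 2 * k + 8 * (t + 1)`. -/
def doublePrimeGraph (t k : ℕ) : SimpleGraph (DoublePrimeVertex t k) :=
  triangleInsertion (primeGraph t) (insertionSet t k)

/-- The Lucchesi–Murty conjecture (for simple bricks, hence implied by its version for bricks
with multiple edges): for some positive `N`, every brick on `n ≥ N` vertices has at least `n - 1`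
perfect matchings. -/
def LucchesiMurtyConjecture : Prop :=
  ∃ N : ℕ, 0 < N ∧ ∀ n : ℕ, N ≤ n → ∀ (V : Type) [Finite V] (G : SimpleGraph V),
    Nat.card V = n → IsBrick G → (n : ℤ) - 1 ≤ numPM G

end ExtremalBrick

/-!
The proof avoids the theory of bricks and splicing and rests on linear algebra and an explicit list
of the perfect matchings.

A perfect matching after triangle-insertions at a set `T` of vertices of degree three leaves, on the
edges of the original graph, a spanning subgraph with degree one outside `T` and degree one or three
in `T`, and is determined by it (`oddFactorEquiv`). In `G'_t` such a subgraph uses exactly one edge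
at `u'`. Follow the two edges leading from each path to the next one. Up to the path at which the
edge at `u'` is attached, the degree conditions force both or none of these edges to be used, and
both only directly before that path; behind it exactly one of them is used, and from the second step
on it is the second. So the subgraph is determined by the neighbour `x` of `u'` and a
bounded local choice (`IsOdd.ext`): there is one subgraph with degree one at each `x`, one with
degree three at each `x` in `T`, and one more for each of `t` of the neighbours
(`IsOdd.exists_eq_factor`). Their number is `3 * t + 5 + |T|`, which equals `|E| - |V| + 1` after
the triangle-insertions.

The subgraphs are linearly independent (`linearIndependent_factor`), so the number of perfect
matchings is the rank of the matching lattice. Comparing dimensions, the vertex stars then span all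
functionals that are constant on the perfect matchings (`exists_endSum_eq`). In particular the
indicator of a tight cut has the form `ab ↦ x a + x b` for a vertex weighting `x` of total weight
one. A triangle forces `x` to be integral, and `0` or `1` on its corners. At a vertex `w` outside the
triangles one exhibits a subgraph with degree three at `w` and one elsewhere; summing over its edges
gives `0 ≤ 1 + 2 x w`, so `x w ≥ 0`. Hence `x` is the indicator of a single vertex and the
cut is trivial (`ncard_eq_one_of_weights`). All of this works for every nonempty set `T` of
neighbours of `u'` (`isExtremalBrick_triangleInsertion`); the sets `S_k` only fix the number of
vertices.
-/

namespace ExtremalBrick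

/-! ### Perfect matchings and tight cuts -/

section Criterion

variable {V : Type*}

open SimpleGraph

/-- Perfect matchings of `G`, viewed as the spanning one-regular graphs below `G`. -/
def perfectMatchingEquiv (G : SimpleGraph V) :
    {M : G.Subgraph // M.IsPerfectMatching} ≃
      {L : SimpleGraph V // L ≤ G ∧ ∀ v, ∃! w, L.Adj v w} where
  toFun M := ⟨M.1.spanningCoe, M.1.spanningCoe_le, by
    intro v
    simpa using Subgraph.isPerfectMatching_iff.1 M.2 v⟩
  invFun L := ⟨SimpleGraph.toSubgraph L.1 L.2.1, by
    rw [Subgraph.isPerfectMatching_iff]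
    exact L.2.2⟩
  left_inv M := by
    apply Subtype.ext
    apply Subgraph.ext
    · exact (M.2.2.verts_eq_univ).symm
    · rfl
  right_inv L := by
    apply Subtype.ext
    ext
    rfl

/-- A property that passes to neighbours holds everywhere in a connected graph. -/
theorem forall_of_connected {G : SimpleGraph V} (hG : G.Connected) {p : V → Prop}
    (hp : ∀ a b, G.Adj a b → p a → p b) {a : V} (ha : p a) (b : V) : p b := by
  obtain ⟨w⟩ := hG.preconnected a b
  induction w with
  | nil => exact ha
  | cons h _ ih => exact ih (hp _ _ h ha)

/-- `G` has a spanning subgraph with degree three at `w` and degree one at all other vertices. -/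
def HasTripleFactor (G : SimpleGraph V) (w : V) : Prop :=
  ∃ L ≤ G, (L.neighborSet w).ncard = 3 ∧ ∀ v, v ≠ w → (L.neighborSet v).ncard = 1

variable [Fintype V]

open Classical in
/-- The linear map sending a vertex weighting to the edge weighting whose value at `ab` is the
sum of the weights of `a` and `b`. -/
noncomputable def endSum (G : SimpleGraph V) : (V → ℚ) →ₗ[ℚ] (G.edgeSet → ℚ) where
  toFun x e := ∑ v, if v ∈ (e : Sym2 V) then x v else 0
  map_add' x y := by
    ext e
    simp only [Pi.add_apply, ← Finset.sum_add_distrib]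
    refine Finset.sum_congr rfl fun v _ => ?_
    split_ifs <;> simp
  map_smul' c x := by
    ext e
    simp only [Pi.smul_apply, smul_eq_mul, Finset.mul_sum, RingHom.id_apply]
    refine Finset.sum_congr rfl fun v _ => ?_
    split_ifs <;> simp

theorem endSum_apply {G : SimpleGraph V} (x : V → ℚ) {a b : V} (h : G.Adj a b) :
    endSum G x ⟨s(a, b), h⟩ = x a + x b := by
  classical
  have hne := h.ne
  have : ∀ v, (if v ∈ s(a, b) then x v else 0) =
      (if v = a then x v else 0) + (if v = b then x v else 0) := by
    intro v
    simp only [Sym2.mem_iff]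
    by_cases h1 : v = a
    · subst h1
      simp [hne]
    · by_cases h2 : v = b
      · subst h2
        simp [hne.symm]
      · simp [h1, h2]
  simp only [endSum, LinearMap.coe_mk, AddHom.coe_mk]
  simp only [this, Finset.sum_add_distrib, Finset.sum_ite_eq', Finset.mem_univ, if_true]

open Classical in
/-- A perfect matching has exactly one edge at each vertex. -/
theorem sum_incidenceVector_endSum {G : SimpleGraph V} {M : G.Subgraph}
    (hM : M.IsPerfectMatching) (x : V → ℚ) :
    ∑ e, (incidenceVector G M e : ℚ) * endSum G x e = ∑ v, x v := by
  simp only [endSum, LinearMap.coe_mk, AddHom.coe_mk, Finset.mul_sum]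
  rw [Finset.sum_comm]
  refine Finset.sum_congr rfl fun v _ => ?_
  obtain ⟨w, hw, huniq⟩ := Subgraph.isPerfectMatching_iff.1 hM v
  rw [Finset.sum_eq_single ⟨s(v, w), M.adj_sub hw⟩]
  · simp [incidenceVector, Set.indicator, hw]
  · rintro ⟨e, he⟩ - hne
    by_cases hv : v ∈ e
    · obtain ⟨u, rfl⟩ := Sym2.mem_iff_exists.1 hv
      have : ¬ M.Adj v u := by
        intro h
        exact hne (Subtype.ext (congrArg (fun z => s(v, z)) (huniq u h)))
      simp [incidenceVector, Set.indicator, this]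
    · simp [hv]
  · simp

open Classical in
/-- If the incidence vectors of the perfect matchings are linearly independent and their number
is `|E| - |V| + 1`, then every functional constant on the perfect matchings is a combination of
vertex stars. The proof compares dimensions: the functionals vanishing on the perfect matchings
and the combinations of stars with coefficient sum zero both have dimension `|V| - 1`. -/
theorem exists_endSum_eq {G : SimpleGraph V} (hconn : G.Connected)
    {a b c : V} (hab : G.Adj a b) (hac : G.Adj a c) (hbc : G.Adj b c)
    (hli : LinearIndependent ℚ fun (M : {M : G.Subgraph // M.IsPerfectMatching}) (e : G.edgeSet) =>
      (incidenceVector G M.1 e : ℚ))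
    (hcard : numPM G + Fintype.card V = G.edgeSet.ncard + 1)
    {q : ℚ} (f : G.edgeSet → ℚ) (hf : ∀ M : G.Subgraph, M.IsPerfectMatching →
      ∑ e, (incidenceVector G M e : ℚ) * f e = q) :
    ∃ x : V → ℚ, f = endSum G x := by
  let P := {M : G.Subgraph // M.IsPerfectMatching}
  let A : Matrix P G.edgeSet ℚ := Matrix.of fun M e => (incidenceVector G M.1 e : ℚ)
  have hrank : A.rank = Fintype.card P := LinearIndependent.rank_matrix hli
  have hker := LinearMap.finrank_range_add_finrank_ker A.mulVecLin
  rw [← Matrix.rank, hrank, Module.finrank_fintype_fun_eq_card] at hker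
  have hP : Fintype.card P = numPM G := by rw [numPM, Nat.card_eq_fintype_card]
  have hE : Fintype.card G.edgeSet = G.edgeSet.ncard := by
    rw [Set.ncard_def, Set.encard, ENat.card_eq_coe_fintype_card]; rfl
  let s : (V → ℚ) →ₗ[ℚ] ℚ := ∑ v, LinearMap.proj v
  have hs : ∀ x, s x = ∑ v, x v := fun x => by simp [s]
  have hV : 0 < Fintype.card V := Fintype.card_pos_iff.2 ⟨a⟩
  have hsker : Module.finrank ℚ (LinearMap.ker s) + 1 = Fintype.card V := by
    have h1 := LinearMap.finrank_range_add_finrank_ker s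
    have h2 : LinearMap.range s = ⊤ := by
      rw [LinearMap.range_eq_top]
      intro y
      exact ⟨Pi.single a y, by rw [hs]; simp⟩
    rw [h2, finrank_top, Module.finrank_self, Module.finrank_fintype_fun_eq_card] at h1
    omega
  have hinj : Function.Injective (endSum G) := by
    rw [← LinearMap.ker_eq_bot, LinearMap.ker_eq_bot']
    intro x hx
    have hedge : ∀ u v, G.Adj u v → x u + x v = 0 := by
      intro u v h
      rw [← endSum_apply x h, hx]; rfl
    have ha : x a = 0 := by linarith [hedge _ _ hab, hedge _ _ hac, hedge _ _ hbc]
    ext v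
    refine forall_of_connected (p := fun v => x v = 0) hconn ?_ ha v
    intro u v h hu
    have := hedge _ _ h
    rw [hu] at this
    linarith
  have hle : (LinearMap.ker s).map (endSum G) ≤ LinearMap.ker A.mulVecLin := by
    rintro _ ⟨x, hx, rfl⟩
    rw [LinearMap.mem_ker]
    ext M
    have hx' : s x = 0 := hx
    simp only [Matrix.mulVecLin_apply, Matrix.mulVec, dotProduct, A, Matrix.of_apply, Pi.zero_apply]
    rw [sum_incidenceVector_endSum M.2, ← hs, hx']
  have heq := Submodule.eq_of_le_of_finrank_eq hle (by
    rw [← (Submodule.equivMapOfInjective (endSum G) hinj (LinearMap.ker s)).finrank_eq]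
    omega)
  -- Subtracting `q` times the star of `a` reduces to a functional with value zero.
  let y : V → ℚ := Pi.single a q
  have hmem : f - endSum G y ∈ LinearMap.ker A.mulVecLin := by
    rw [LinearMap.mem_ker]
    ext M
    simp only [Matrix.mulVecLin_apply, Matrix.mulVec, dotProduct, A, Matrix.of_apply, Pi.zero_apply,
      Pi.sub_apply, mul_sub, Finset.sum_sub_distrib]
    rw [sum_incidenceVector_endSum M.2, hf M.1 M.2]
    simp [y]
  rw [← heq] at hmem
  obtain ⟨x, -, hx⟩ := hmem
  exact ⟨x + y, by rw [map_add, hx]; simp⟩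

open Classical in
/-- A subgraph `L` of `G` with degree three at `w` and degree one elsewhere shows that a vertex
weighting of total weight `1`, nonnegative on all edges, has weight greater than `-1` at `w`:
summing over the edges of `L` gives `0 ≤ 1 + 2 x w`. -/
theorem neg_one_lt_of_triple {G L : SimpleGraph V} (hL : L ≤ G) {w : V}
    (hdeg3 : (L.neighborSet w).ncard = 3) (hdeg1 : ∀ v, v ≠ w → (L.neighborSet v).ncard = 1)
    {x : V → ℚ} (hx : ∀ a b, G.Adj a b → 0 ≤ x a + x b) (hsum : ∑ v, x v = 1) : -1 < x w := by
  have hpos : 0 ≤ ∑ v, ∑ u, if L.Adj v u then x v + x u else 0 := by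
    refine Finset.sum_nonneg fun v _ => Finset.sum_nonneg fun u _ => ?_
    split_ifs with h
    · exact hx _ _ (hL h)
    · exact le_rfl
  have hd : ∀ v, ∑ u, (if L.Adj v u then x v else 0) = ((L.neighborSet v).ncard : ℚ) * x v := by
    intro v
    rw [← Finset.sum_filter, Finset.sum_const, nsmul_eq_mul, Set.ncard_eq_toFinset_card']
    congr 3
    ext u
    simp
  have hsplit : ∑ v, ∑ u, (if L.Adj v u then x v + x u else 0) =
      2 * ∑ v, ((L.neighborSet v).ncard : ℚ) * x v := by
    have h1 : ∀ v u, (if L.Adj v u then x v + x u else 0) =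
        (if L.Adj v u then x v else 0) + (if L.Adj u v then x u else 0) := by
      intro v u
      rw [L.adj_comm u v]
      split_ifs <;> simp
    simp only [h1, Finset.sum_add_distrib, hd]
    rw [Finset.sum_comm (f := fun v u => if L.Adj u v then x u else 0)]
    simp only [hd]
    ring
  have h3 : ∑ v, ((L.neighborSet v).ncard : ℚ) * x v = 1 + 2 * x w := by
    rw [← hsum]
    have : ∀ v, ((L.neighborSet v).ncard : ℚ) * x v = x v + if v = w then 2 * x v else 0 := by
      intro v
      split_ifs with h
      · rw [h, hdeg3]
        push_cast
        ring
      · rw [hdeg1 v h]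
        simp
    simp only [this, Finset.sum_add_distrib, Finset.sum_ite_eq', Finset.mem_univ, if_true]
  rw [hsplit, h3] at hpos
  linarith

/-- If the edge sums of a vertex weighting of total weight `1` are the indicator of a cut, and each
vertex lies in a triangle or has degree three in a subgraph with degree one elsewhere, then the
cut is trivial. The weights are integers and nonnegative, hence the weighting is the indicator
of a vertex, and the cut is the star of that vertex. -/
theorem ncard_eq_one_of_weights {G : SimpleGraph V} (hconn : G.Connected)
    {a b c : V} (hab : G.Adj a b) (hac : G.Adj a c) (hbc : G.Adj b c)
    (hw : ∀ w, (∃ u v, G.Adj w u ∧ G.Adj w v ∧ G.Adj u v) ∨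
      HasTripleFactor G w)
    {X : Set V} {x : V → ℚ} (hsum : ∑ v, x v = 1)
    (hx0 : ∀ u v, G.Adj u v → (u ∈ X ↔ v ∈ X) → x u + x v = 0)
    (hx1 : ∀ u v, G.Adj u v → ¬ (u ∈ X ↔ v ∈ X) → x u + x v = 1) :
    X.ncard = 1 ∨ Xᶜ.ncard = 1 := by
  classical
  -- A cut meets a triangle in no edge or in two edges, which excludes the weights `± 1 / 2`.
  have htri : ∀ w u v, G.Adj w u → G.Adj w v → G.Adj u v → x w = 0 ∨ x w = 1 := by
    intro w u v h1 h2 h3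
    have a0 := hx0 _ _ h1
    have a1 := hx1 _ _ h1
    have b0 := hx0 _ _ h2
    have b1 := hx1 _ _ h2
    have c0 := hx0 _ _ h3
    have c1 := hx1 _ _ h3
    by_cases hwX : w ∈ X <;> by_cases huX : u ∈ X <;> by_cases hvX : v ∈ X <;>
      simp only [hwX, huX, hvX, iff_true, iff_false, true_imp_iff, not_true, not_false_iff,
        false_imp_iff] at a0 a1 b0 b1 c0 c1 <;>
      first
      | (left; linarith)
      | (right; linarith)
  have hint : ∀ v, ∃ n : ℤ, x v = n := by
    refine forall_of_connected (a := a) hconn ?_ ?_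
    · rintro u v huv ⟨n, hn⟩
      by_cases h : u ∈ X ↔ v ∈ X
      · exact ⟨-n, by push_cast; linarith [hx0 _ _ huv h]⟩
      · exact ⟨1 - n, by push_cast; linarith [hx1 _ _ huv h]⟩
    · rcases htri a b c hab hac hbc with h | h
      · exact ⟨0, by simp [h]⟩
      · exact ⟨1, by simp [h]⟩
  have hnonneg : ∀ w, 0 ≤ x w := by
    intro w
    rcases hw w with ⟨u, v, h1, h2, h3⟩ | ⟨L, hL, hdeg3, hdeg1⟩
    · rcases htri w u v h1 h2 h3 with h | h <;> simp [h]
    · have := neg_one_lt_of_triple (w := w) hL hdeg3 hdeg1 (x := x) (by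
        intro p q hpq
        by_cases h : p ∈ X ↔ q ∈ X
        · rw [hx0 _ _ hpq h]
        · rw [hx1 _ _ hpq h]; norm_num) hsum
      obtain ⟨n, hn⟩ := hint w
      rw [hn] at this ⊢
      have h2 : (-1 : ℤ) < n := by exact_mod_cast this
      exact_mod_cast (by omega : (0 : ℤ) ≤ n)
  obtain ⟨w, hw1⟩ : ∃ w, x w ≠ 0 := by
    by_contra! h
    simp [h] at hsum
  have hw1' : x w = 1 := by
    obtain ⟨n, hn⟩ := hint w
    have h1 : x w ≤ 1 := by
      rw [← hsum]
      exact Finset.single_le_sum (fun v _ => hnonneg v) (Finset.mem_univ w)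
    have h0 := hnonneg w
    rw [hn] at h1 h0 hw1 ⊢
    have h1' : n ≤ 1 := by exact_mod_cast h1
    have h0' : 0 ≤ n := by exact_mod_cast h0
    have : n ≠ 0 := by exact_mod_cast hw1
    have : n = 1 := by omega
    simp [this]
  have hzero : ∀ v, v ≠ w → x v = 0 := by
    intro v hv
    have : x v + x w ≤ ∑ u, x u := by
      rw [← Finset.sum_pair hv]
      exact Finset.sum_le_sum_of_subset_of_nonneg (Finset.subset_univ _) fun u _ _ => hnonneg u
    linarith [hnonneg v]
  have hadjw : ∀ v, G.Adj w v → ¬ (w ∈ X ↔ v ∈ X) := by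
    intro v hv h
    have := hx0 _ _ hv h
    rw [hw1', hzero v hv.ne'] at this
    norm_num at this
  have hadj : ∀ u v, G.Adj u v → u ≠ w → v ≠ w → (u ∈ X ↔ v ∈ X) := by
    intro u v huv hu hv
    by_contra h
    have := hx1 _ _ huv h
    rw [hzero u hu, hzero v hv] at this
    norm_num at this
  -- No edge leaves the side of `w` after the removal of `w`, so by connectivity nothing is left.
  have hside : ∀ v, v ≠ w → ¬ (w ∈ X ↔ v ∈ X) := by
    intro v hv hvX
    have := forall_of_connected (p := fun u => u ≠ w ∧ (w ∈ X ↔ u ∈ X)) hconn (by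
      rintro p q hpq ⟨hp, hpX⟩
      have hq : q ≠ w := by
        rintro rfl
        exact hadjw p hpq.symm hpX
      exact ⟨hq, hpX.trans (hadj p q hpq hp hq)⟩) (a := v) ⟨hv, hvX⟩ w
    exact this.1 rfl
  by_cases hwX : w ∈ X
  · left
    rw [Set.ncard_eq_one]
    refine ⟨w, Set.eq_singleton_iff_unique_mem.2 ⟨hwX, fun v hv => ?_⟩⟩
    by_contra h
    exact hside v h (by simp [hwX, hv])
  · right
    rw [Set.ncard_eq_one]
    refine ⟨w, Set.eq_singleton_iff_unique_mem.2 ⟨hwX, fun v hv => ?_⟩⟩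
    by_contra h
    exact hside v h (by simpa [hwX] using hv)

/-- A matching covered graph with a triangle whose perfect matchings are linearly independent and
`|E| - |V| + 1` in number is an extremal brick, provided that each vertex lies in a triangle or has
degree three in some subgraph with degree one at all other vertices. -/
theorem isExtremalBrick_of_linearIndependent {G : SimpleGraph V} (hG : IsMatchingCovered G)
    {a b c : V} (hab : G.Adj a b) (hac : G.Adj a c) (hbc : G.Adj b c)
    (hw : ∀ w, (∃ u v, G.Adj w u ∧ G.Adj w v ∧ G.Adj u v) ∨
      HasTripleFactor G w)
    (hli : LinearIndependent ℚ fun (M : {M : G.Subgraph // M.IsPerfectMatching}) (e : G.edgeSet) =>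
      (incidenceVector G M.1 e : ℚ))
    (hcard : numPM G + Fintype.card V = G.edgeSet.ncard + 1) :
    IsExtremalBrick G := by
  classical
  refine ⟨⟨hG, ?_, ?_⟩, ?_⟩
  · rintro ⟨col⟩
    have h1 := col.valid hab
    have h2 := col.valid hac
    have h3 := col.valid hbc
    omega
  · intro X hX
    let f : G.edgeSet → ℚ := fun e => if (e : Sym2 V) ∈ edgeCut G X then 1 else 0
    have hf : ∀ M : G.Subgraph, M.IsPerfectMatching →
        ∑ e, (incidenceVector G M e : ℚ) * f e = 1 := by
      intro M hM
      obtain ⟨e, he⟩ := Set.ncard_eq_one.1 (hX M hM)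
      have hmem : e ∈ M.edgeSet ∩ edgeCut G X := by rw [he]; rfl
      rw [Finset.sum_eq_single ⟨e, hmem.2.1⟩]
      · simp [f, incidenceVector, hmem.1, hmem.2]
      · rintro ⟨e', he'⟩ - hne
        by_cases h1 : e' ∈ M.edgeSet
        · by_cases h2 : e' ∈ edgeCut G X
          · have : e' ∈ M.edgeSet ∩ edgeCut G X := ⟨h1, h2⟩
            rw [he] at this
            exact absurd (Subtype.ext (Set.mem_singleton_iff.1 this)) hne
          · simp [f, h2]
        · simp [incidenceVector, h1]
      · simp
    obtain ⟨x, hx⟩ := exists_endSum_eq hG.2.1 hab hac hbc hli hcard f hf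
    obtain ⟨M, hM, -⟩ := hG.2.2 s(a, b) hab
    have hedge : ∀ u v (h : G.Adj u v), x u + x v = f ⟨s(u, v), h⟩ := by
      intro u v h
      rw [hx, endSum_apply]
    have hcut : ∀ u v, G.Adj u v → (s(u, v) ∈ edgeCut G X ↔ ¬ (u ∈ X ↔ v ∈ X)) := by
      intro u v h
      constructor
      · rintro ⟨-, p, hp, q, hq, hpq⟩
        rcases Sym2.eq_iff.1 hpq with ⟨rfl, rfl⟩ | ⟨rfl, rfl⟩ <;> tauto
      · intro hne
        refine ⟨h, ?_⟩
        by_cases hu : u ∈ X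
        · exact ⟨u, hu, v, by tauto, rfl⟩
        · exact ⟨v, by tauto, u, hu, Sym2.eq_swap⟩
    refine ncard_eq_one_of_weights hG.2.1 hab hac hbc hw (X := X) (x := x) ?_ ?_ ?_
    · rw [← sum_incidenceVector_endSum hM x, ← hx, hf M hM]
    · intro u v h huv
      rw [hedge u v h]
      simp [f, hcut u v h, huv]
    · intro u v h huv
      rw [hedge u v h]
      simp [f, hcut u v h, huv]
  · have hZ : LinearIndependent ℤ
        fun M : {M : G.Subgraph // M.IsPerfectMatching} => incidenceVector G M.1 := by
      refine LinearIndependent.of_comp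
        ((Algebra.linearMap ℤ ℚ).compLeft G.edgeSet) ?_
      refine LinearIndependent.restrict_scalars (R := ℤ) (K := ℚ) ?_ hli
      intro m n h
      simpa using h
    rw [numPM, Nat.card_eq_fintype_card, ← finrank_span_eq_card hZ, matchingLattice]
    have hrange : (Set.range fun M : {M : G.Subgraph // M.IsPerfectMatching} =>
        incidenceVector G M.1) = {x | ∃ M : G.Subgraph, M.IsPerfectMatching ∧
          x = incidenceVector G M} := by
      ext y
      constructor
      · rintro ⟨M, rfl⟩
        exact ⟨M.1, M.2, rfl⟩
      · rintro ⟨M, hM, rfl⟩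
        exact ⟨⟨M, hM⟩, rfl⟩
    rw [hrange]
end Criterion

/-! ### Perfect matchings after triangle-insertions -/

section Insertion

open SimpleGraph

/-- Exactly one of three propositions holds. -/
def ExactlyOne (p q r : Prop) : Prop :=
  (p ∧ ¬ q ∧ ¬ r) ∨ (¬ p ∧ q ∧ ¬ r) ∨ (¬ p ∧ ¬ q ∧ r)

theorem existsUnique_iff_exactlyOne {α : Type*} {p : α → Prop} {a b c : α} (hab : a ≠ b)
    (hac : a ≠ c) (hbc : b ≠ c) (h : ∀ y, p y → y = a ∨ y = b ∨ y = c) :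
    (∃! y, p y) ↔ ExactlyOne (p a) (p b) (p c) := by
  unfold ExactlyOne ExistsUnique
  constructor
  · rintro ⟨y, hy, hu⟩
    have := hu a
    have := hu b
    have := hu c
    rcases h y hy with rfl | rfl | rfl <;> grind
  · rintro (⟨h1, h2, h3⟩ | ⟨h1, h2, h3⟩ | ⟨h1, h2, h3⟩)
    · exact ⟨a, h1, fun y hy => by rcases h y hy with rfl | rfl | rfl <;> grind⟩
    · exact ⟨b, h2, fun y hy => by rcases h y hy with rfl | rfl | rfl <;> grind⟩
    · exact ⟨c, h3, fun y hy => by rcases h y hy with rfl | rfl | rfl <;> grind⟩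

variable {V : Type*} {G : SimpleGraph V} {T : Set V}

/-- Every vertex of `H ≤ G` has degree one, or lies in `T` and keeps all its edges. When the
vertices of `T` have degree three in `G`, these `H` are the traces of the perfect matchings of
`triangleInsertion G T` on the edges of `G`. -/
def IsOddFactor (G : SimpleGraph V) (T : Set V) (H : SimpleGraph V) : Prop :=
  H ≤ G ∧ ∀ v, (∃! w, H.Adj v w) ∨ (v ∈ T ∧ ∀ w, G.Adj v w → H.Adj v w)

/-- The vertex of `G` from which a vertex of `triangleInsertion G T` stems. -/
def base : InsertionVertex G T → V
  | .inl v => v.1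
  | .inr d => d.1.fst

open Classical in
/-- The end, on the side of `v`, of the edge of `triangleInsertion G T` that stems from `vw`. -/
noncomputable def port (T : Set V) {v w : V} (h : G.Adj v w) : InsertionVertex G T :=
  if hv : v ∈ T then .inr ⟨⟨(v, w), h⟩, hv⟩ else .inl ⟨v, hv⟩

theorem port_of_mem {v w : V} (h : G.Adj v w) (hv : v ∈ T) :
    port T h = .inr ⟨⟨(v, w), h⟩, hv⟩ := by
  simp [port, hv]

theorem port_of_notMem {v w : V} (h : G.Adj v w) (hv : v ∉ T) :
    port T h = .inl ⟨v, hv⟩ := by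
  simp [port, hv]

@[simp]
theorem base_port {v w : V} (h : G.Adj v w) : base (port T h) = v := by
  by_cases hv : v ∈ T
  · rw [port_of_mem h hv]; rfl
  · rw [port_of_notMem h hv]; rfl

theorem port_injective {v w w' : V} (hv : v ∈ T) (h : G.Adj v w) (h' : G.Adj v w')
    (heq : port T h = port T h') : w = w' := by
  rw [port_of_mem h hv, port_of_mem h' hv] at heq
  simpa using heq

theorem eq_of_base_eq_of_notMem {x y : InsertionVertex G T} (h : base x = base y)
    (hx : base x ∉ T) : x = y := by
  rcases x with v | d <;> rcases y with w | e
  · exact congrArg _ (Subtype.ext h)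
  · exact absurd (h ▸ e.2) hx
  · exact absurd d.2 hx
  · exact absurd d.2 hx

theorem adj_port {v w : V} (h : G.Adj v w) :
    (triangleInsertion G T).Adj (port T h) (port T h.symm) := by
  by_cases hv : v ∈ T <;> by_cases hw : w ∈ T
  · rw [port_of_mem h hv, port_of_mem h.symm hw]
    exact Or.inr rfl
  · rw [port_of_mem h hv, port_of_notMem h.symm hw]
    rfl
  · rw [port_of_notMem h hv, port_of_mem h.symm hw]
    rfl
  · rw [port_of_notMem h hv, port_of_notMem h.symm hw]
    exact h

theorem adj_port_port {v w w' : V} (hv : v ∈ T) (h : G.Adj v w) (h' : G.Adj v w') (hne : w ≠ w') :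
    (triangleInsertion G T).Adj (port T h) (port T h') := by
  rw [port_of_mem h hv, port_of_mem h' hv]
  exact Or.inl ⟨rfl, by simpa using hne⟩

/-- The edges of `triangleInsertion G T` are the edges stemming from `G` and those of the
triangles. -/
theorem adj_cases {x y : InsertionVertex G T} (h : (triangleInsertion G T).Adj x y) :
    (∃ v w, ∃ h : G.Adj v w, x = port T h ∧ y = port T h.symm) ∨
      ∃ v a b, ∃ (ha : G.Adj v a) (hb : G.Adj v b),
        v ∈ T ∧ a ≠ b ∧ x = port T ha ∧ y = port T hb := by
  rcases x with ⟨v, hv⟩ | ⟨⟨⟨v, v'⟩, hd⟩, hv⟩ <;> rcases y with ⟨w, hw⟩ | ⟨⟨⟨w, w'⟩, he⟩, hw⟩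
  · exact Or.inl ⟨v, w, h, (port_of_notMem _ hv).symm, (port_of_notMem _ hw).symm⟩
  · obtain rfl : w' = v := h
    exact Or.inl ⟨w', w, he.symm, (port_of_notMem _ hv).symm, (port_of_mem _ hw).symm⟩
  · obtain rfl : v' = w := h
    exact Or.inl ⟨v, v', hd, (port_of_mem _ hv).symm, (port_of_notMem _ hw).symm⟩
  · rcases h with ⟨h, hne⟩ | h
    · obtain rfl : v = w := h
      refine Or.inr ⟨v, v', w', hd, he, hv, ?_, (port_of_mem _ hv).symm, (port_of_mem _ hv).symm⟩
      simpa using hne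
    · obtain ⟨rfl, rfl⟩ : w = v' ∧ w' = v := by simpa [Dart.ext_iff] using h
      exact Or.inl ⟨w', w, hd, (port_of_mem _ hv).symm, (port_of_mem _ hw).symm⟩

theorem eq_of_adj_port {v a b c : V} (hv : v ∈ T) (hN : ∀ w, G.Adj v w ↔ w = a ∨ w = b ∨ w = c)
    (ha : G.Adj v a) (hb : G.Adj v b) (hc : G.Adj v c) {y : InsertionVertex G T}
    (hy : (triangleInsertion G T).Adj (port T ha) y) :
    y = port T ha.symm ∨ y = port T hb ∨ y = port T hc := by
  rcases adj_cases hy with ⟨v', w, h, h1, rfl⟩ | ⟨v', a', b', ha', hb', -, hne, h1, rfl⟩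
  · obtain rfl : v = v' := by simpa using congrArg base h1
    obtain rfl := port_injective hv ha h h1
    exact Or.inl rfl
  · obtain rfl : v = v' := by simpa using congrArg base h1
    obtain rfl := port_injective hv ha ha' h1
    rcases (hN b').1 hb' with rfl | rfl | rfl
    · exact absurd rfl hne
    · exact Or.inr (Or.inl rfl)
    · exact Or.inr (Or.inr rfl)

/-- The subgraph of `G` formed by the edges that survive in `L`. -/
def trace (L : SimpleGraph (InsertionVertex G T)) : SimpleGraph V where
  Adj v w := ∃ h : G.Adj v w, L.Adj (port T h) (port T h.symm)
  symm := ⟨fun _ _ ⟨h, h'⟩ => ⟨h.symm, h'.symm⟩⟩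
  loopless := ⟨fun _ ⟨h, _⟩ => G.loopless.irrefl _ h⟩

theorem trace_le (L : SimpleGraph (InsertionVertex G T)) : trace L ≤ G := fun _ _ h => h.1

theorem trace_adj {L : SimpleGraph (InsertionVertex G T)} {v w : V} (h : G.Adj v w) :
    (trace L).Adj v w ↔ L.Adj (port T h) (port T h.symm) :=
  ⟨fun h' => h'.2, fun h' => ⟨h, h'⟩⟩

/-- A corner of an inserted triangle whose edge stemming from `G` lies in `H`. -/
def IsOuter (H : SimpleGraph V) : InsertionVertex G T → Prop
  | .inl _ => False
  | .inr d => H.Adj d.1.fst d.1.snd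

theorem isOuter_port {H : SimpleGraph V} {v w : V} (hv : v ∈ T) (h : G.Adj v w) :
    IsOuter H (port T h) ↔ H.Adj v w := by
  rw [port_of_mem h hv]; rfl

/-- Extend `H` by the edges of the inserted triangles whose ends are not incident with an edge
of `H`. -/
def lift (T : Set V) (H : SimpleGraph V) : SimpleGraph (InsertionVertex G T) where
  Adj x y := (triangleInsertion G T).Adj x y ∧
    (H.Adj (base x) (base y) ∨ (base x = base y ∧ ¬ IsOuter H x ∧ ¬ IsOuter H y))
  symm := ⟨fun _ _ ⟨h, h'⟩ => ⟨h.symm, h'.imp (fun h => h.symm) fun h => ⟨h.1.symm, h.2.2, h.2.1⟩⟩⟩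
  loopless := ⟨fun _ ⟨h, _⟩ => (triangleInsertion G T).loopless.irrefl _ h⟩

theorem lift_le (H : SimpleGraph V) : lift T H ≤ triangleInsertion G T := fun _ _ h => h.1

theorem lift_adj_cross {H : SimpleGraph V} {v w : V} (h : G.Adj v w) :
    (lift T H).Adj (port T h) (port T h.symm) ↔ H.Adj v w := by
  simp [lift, adj_port, h.ne]

theorem lift_adj_inner {H : SimpleGraph V} {v w w' : V} (hv : v ∈ T) (h : G.Adj v w)
    (h' : G.Adj v w') (hne : w ≠ w') :
    (lift T H).Adj (port T h) (port T h') ↔ ¬ H.Adj v w ∧ ¬ H.Adj v w' := by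
  simp [lift, adj_port_port hv h h' hne, isOuter_port hv]

theorem trace_lift {H : SimpleGraph V} (hH : H ≤ G) : trace (lift (G := G) T H) = H := by
  ext v w
  constructor
  · rintro ⟨h, h'⟩
    exact (lift_adj_cross h).1 h'
  · intro h
    exact (trace_adj (hH h)).2 ((lift_adj_cross (hH h)).2 h)

theorem trace_triangleInsertion : trace (triangleInsertion G T) = G := by
  ext v w
  exact ⟨fun h => h.1, fun h => ⟨h, adj_port h⟩⟩

/-- The three neighbours of a vertex of degree three, listed with a given one in front. -/
theorem exists_neighbors {v a : V} (hv : (G.neighborSet v).ncard = 3) (ha : G.Adj v a) :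
    ∃ b c, a ≠ b ∧ a ≠ c ∧ b ≠ c ∧ G.Adj v b ∧ G.Adj v c ∧
      ∀ w, G.Adj v w ↔ w = a ∨ w = b ∨ w = c := by
  obtain ⟨x, y, z, hxy, hxz, hyz, h⟩ := Set.ncard_eq_three.1 hv
  have hN : ∀ w, G.Adj v w ↔ w = x ∨ w = y ∨ w = z := by
    intro w
    rw [← mem_neighborSet, h]
    simp
  rcases (hN a).1 ha with rfl | rfl | rfl
  · exact ⟨y, z, hxy, hxz, hyz, (hN _).2 (by simp), (hN _).2 (by simp), hN⟩
  · exact ⟨x, z, hxy.symm, hyz, hxz, (hN _).2 (by simp), (hN _).2 (by simp),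
      fun w => by rw [hN]; tauto⟩
  · exact ⟨x, y, hxz.symm, hyz.symm, hxy, (hN _).2 (by simp), (hN _).2 (by simp),
      fun w => by rw [hN]; tauto⟩

theorem existsUnique_adj_iff {H : SimpleGraph V} (hH : H ≤ G) {v a b c : V} (hab : a ≠ b)
    (hac : a ≠ c) (hbc : b ≠ c) (hN : ∀ w, G.Adj v w ↔ w = a ∨ w = b ∨ w = c) :
    (∃! w, H.Adj v w) ↔ ExactlyOne (H.Adj v a) (H.Adj v b) (H.Adj v c) :=
  existsUnique_iff_exactlyOne hab hac hbc fun y hy => (hN y).1 (hH hy)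

theorem existsUnique_port_adj_iff {L : SimpleGraph (InsertionVertex G T)}
    (hL : L ≤ triangleInsertion G T) {v a b c : V} (hv : v ∈ T) (hbc : b ≠ c)
    (hN : ∀ w, G.Adj v w ↔ w = a ∨ w = b ∨ w = c)
    (ha : G.Adj v a) (hb : G.Adj v b) (hc : G.Adj v c) :
    (∃! y, L.Adj (port T ha) y) ↔ ExactlyOne ((trace L).Adj v a)
      (L.Adj (port T ha) (port T hb)) (L.Adj (port T ha) (port T hc)) := by
  rw [trace_adj ha]
  refine existsUnique_iff_exactlyOne ?_ ?_ ?_ fun y hy => eq_of_adj_port hv hN ha hb hc (hL hy)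
  · intro h
    have := congrArg base h
    simp only [base_port] at this
    exact ha.ne this.symm
  · intro h
    have := congrArg base h
    simp only [base_port] at this
    exact ha.ne this.symm
  · exact fun h => hbc (port_injective hv hb hc h)

/-- In the triangle inserted at `v`, matched by edges stemming from `G` and edges of the triangle,
either one or all three of the former edges are used, and they determine the latter. -/
theorem trace_corner {L : SimpleGraph (InsertionVertex G T)}
    (hL : L ≤ triangleInsertion G T) (hdeg : ∀ x, ∃! y, L.Adj x y) {v a b c : V} (hv : v ∈ T)
    (hab : a ≠ b) (hac : a ≠ c) (hbc : b ≠ c) (hN : ∀ w, G.Adj v w ↔ w = a ∨ w = b ∨ w = c)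
    (ha : G.Adj v a) (hb : G.Adj v b) (hc : G.Adj v c) :
    (ExactlyOne ((trace L).Adj v a) ((trace L).Adj v b) ((trace L).Adj v c) ∨
      ((trace L).Adj v a ∧ (trace L).Adj v b ∧ (trace L).Adj v c)) ∧
    (L.Adj (port T ha) (port T hb) ↔ ¬ (trace L).Adj v a ∧ ¬ (trace L).Adj v b) := by
  have h1 := (existsUnique_port_adj_iff hL hv hbc hN ha hb hc).1 (hdeg _)
  have h2 := (existsUnique_port_adj_iff hL hv hac
    (fun w => by rw [hN]; tauto) hb ha hc).1 (hdeg _)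
  have h3 := (existsUnique_port_adj_iff hL hv hab
    (fun w => by rw [hN]; tauto) hc ha hb).1 (hdeg _)
  rw [L.adj_comm (port T hb) (port T ha)] at h2
  rw [L.adj_comm (port T hc) (port T ha), L.adj_comm (port T hc) (port T hb)] at h3
  unfold ExactlyOne at *
  grind

theorem lift_trace {L : SimpleGraph (InsertionVertex G T)}
    (hT : ∀ v ∈ T, (G.neighborSet v).ncard = 3)
    (hL : L ≤ triangleInsertion G T) (hdeg : ∀ x, ∃! y, L.Adj x y) : lift T (trace L) = L := by
  have key : ∀ x y, (triangleInsertion G T).Adj x y →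
      ((lift T (trace L)).Adj x y ↔ L.Adj x y) := by
    intro x y hxy
    rcases adj_cases hxy with ⟨v, w, h, rfl, rfl⟩ | ⟨v, a, b, ha, hb, hbT, hab, rfl, rfl⟩
    · rw [lift_adj_cross, trace_adj h]
    · rw [lift_adj_inner hbT ha hb hab]
      obtain ⟨p, q, hap, haq, hpq, hp, hq, hN⟩ := exists_neighbors (hT v hbT) ha
      rcases (hN b).1 hb with rfl | rfl | rfl
      · exact absurd rfl hab
      · exact (trace_corner hL hdeg hbT hap haq hpq hN ha hp hq).2.symm
      · exact (trace_corner hL hdeg hbT haq hap hpq.symm (fun w => by rw [hN]; tauto)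
          ha hq hp).2.symm
  ext x y
  exact ⟨fun h => (key x y (lift_le _ h)).1 h, fun h => (key x y (hL h)).2 h⟩

/-- Outside `T` the edges at a vertex are the edges at that vertex in the trace. -/
theorem base_bijOn {L : SimpleGraph (InsertionVertex G T)} (hL : L ≤ triangleInsertion G T) {v : V}
    (hv : v ∉ T) : Set.BijOn base (L.neighborSet (.inl ⟨v, hv⟩)) ((trace L).neighborSet v) := by
  have hcross : ∀ y, L.Adj (.inl ⟨v, hv⟩) y → ∃ h : G.Adj v (base y), y = port T h.symm := by
    intro y hy
    rcases adj_cases (hL hy) with ⟨u, w, h, h1, rfl⟩ | ⟨u, a, b, ha, hb, hu, -, h1, rfl⟩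
    · obtain rfl : v = u := (congrArg base h1).trans (base_port _)
      simpa using h
    · obtain rfl : v = u := (congrArg base h1).trans (base_port _)
      exact absurd hu hv
  refine ⟨?_, ?_, ?_⟩
  · intro y hy
    obtain ⟨h, hy'⟩ := hcross y hy
    refine ⟨h, ?_⟩
    rw [port_of_notMem h hv, ← hy']
    exact hy
  · intro y hy z hz hyz
    obtain ⟨h, hy'⟩ := hcross y hy
    obtain ⟨h', hz'⟩ := hcross z hz
    rw [hy', hz']
    congr!
  · rintro w ⟨h, hw⟩
    refine ⟨port T h.symm, ?_, base_port _⟩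
    rw [port_of_notMem h hv] at hw
    exact hw

theorem ncard_neighborSet_inl {L : SimpleGraph (InsertionVertex G T)}
    (hL : L ≤ triangleInsertion G T) (v : {v : V // v ∉ T}) :
    (L.neighborSet (.inl v)).ncard = ((trace L).neighborSet v.1).ncard := by
  have h := base_bijOn hL v.2
  rw [← h.image_eq, h.injOn.ncard_image]

theorem existsUnique_adj_iff_ncard {α : Type*} {H : SimpleGraph α} {v : α} :
    (∃! w, H.Adj v w) ↔ (H.neighborSet v).ncard = 1 := by
  rw [Set.ncard_eq_one]
  constructor
  · rintro ⟨w, hw, hu⟩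
    exact ⟨w, Set.eq_singleton_iff_unique_mem.2 ⟨hw, hu⟩⟩
  · rintro ⟨w, hw⟩
    exact ⟨w, (Set.eq_singleton_iff_unique_mem.1 hw).1, (Set.eq_singleton_iff_unique_mem.1 hw).2⟩

theorem isOddFactor_trace {L : SimpleGraph (InsertionVertex G T)}
    (hT : ∀ v ∈ T, (G.neighborSet v).ncard = 3)
    (hL : L ≤ triangleInsertion G T) (hdeg : ∀ x, ∃! y, L.Adj x y) :
    IsOddFactor G T (trace L) := by
  refine ⟨trace_le L, fun v => ?_⟩
  by_cases hv : v ∈ T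
  · obtain ⟨a, ha⟩ : (G.neighborSet v).Nonempty := by
      rw [Set.nonempty_iff_ne_empty]
      intro h
      simpa [h] using hT v hv
    obtain ⟨b, c, hab, hac, hbc, hb, hc, hN⟩ := exists_neighbors (hT v hv) ha
    refine (trace_corner hL hdeg hv hab hac hbc hN ha hb hc).1.imp
      (existsUnique_adj_iff (trace_le L) hab hac hbc hN).2 ?_
    rintro ⟨h1, h2, h3⟩
    refine ⟨hv, fun w hw => ?_⟩
    rcases (hN w).1 hw with rfl | rfl | rfl <;> assumption
  · left
    have := ncard_neighborSet_inl hL ⟨v, hv⟩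
    rwa [existsUnique_adj_iff_ncard.1 (hdeg _), eq_comm, ← existsUnique_adj_iff_ncard] at this

/-- The corners of a triangle have degree one in the lift: a corner that is not outer is joined to
the other such corner, and there are two or none of them. -/
theorem existsUnique_lift_adj_inr {H : SimpleGraph V}
    (hT : ∀ v ∈ T, (G.neighborSet v).ncard = 3) (hH : H ≤ G)
    (hdeg : ∀ v ∈ T, (∃! w, H.Adj v w) ∨ ∀ w, G.Adj v w → H.Adj v w)
    (d : {d : G.Dart // d.fst ∈ T}) : ∃! y, (lift T H).Adj (.inr d) y := by
  obtain ⟨⟨⟨v, a⟩, ha⟩, hv⟩ := d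
  obtain ⟨b, c, hab, hac, hbc, hb, hc, hN⟩ := exists_neighbors (hT v hv) ha
  have h := hdeg v hv
  rw [existsUnique_adj_iff hH hab hac hbc hN] at h
  have h2 := existsUnique_port_adj_iff (lift_le (T := T) H) hv hbc hN ha hb hc
  rw [lift_adj_inner hv ha hb hab, lift_adj_inner hv ha hc hac, trace_lift hH,
    port_of_mem ha hv] at h2
  rw [h2]
  have h' : ExactlyOne (H.Adj v a) (H.Adj v b) (H.Adj v c) ∨
      (H.Adj v a ∧ H.Adj v b ∧ H.Adj v c) :=
    h.imp_right fun h => ⟨h _ ha, h _ hb, h _ hc⟩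
  unfold ExactlyOne at *
  grind

theorem existsUnique_lift_adj {H : SimpleGraph V}
    (hT : ∀ v ∈ T, (G.neighborSet v).ncard = 3) (hH : IsOddFactor G T H)
    (x : InsertionVertex G T) : ∃! y, (lift T H).Adj x y := by
  rcases x with v | d
  · rw [existsUnique_adj_iff_ncard, ncard_neighborSet_inl (lift_le H), trace_lift hH.1,
      ← existsUnique_adj_iff_ncard]
    exact (hH.2 v).resolve_right fun h => v.2 h.1
  · exact existsUnique_lift_adj_inr hT hH.1 (fun v hv => (hH.2 v).imp_right fun h => h.2) d

/-- The perfect matchings after the triangle-insertions correspond to the subgraphs of `G` in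
which each vertex has degree one or, if it is in `T`, three. -/
noncomputable def oddFactorEquiv (hT : ∀ v ∈ T, (G.neighborSet v).ncard = 3) :
    {M : (triangleInsertion G T).Subgraph // M.IsPerfectMatching} ≃
      {H : SimpleGraph V // IsOddFactor G T H} :=
  (perfectMatchingEquiv _).trans
    { toFun := fun L => ⟨trace L.1, isOddFactor_trace hT L.2.1 L.2.2⟩
      invFun := fun H => ⟨lift T H.1, lift_le _, existsUnique_lift_adj hT H.2⟩
      left_inv := fun L => Subtype.ext (lift_trace hT L.2.1 L.2.2)
      right_inv := fun H => Subtype.ext (trace_lift H.2.1) }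

theorem oddFactorEquiv_adj (hT : ∀ v ∈ T, (G.neighborSet v).ncard = 3)
    (M : {M : (triangleInsertion G T).Subgraph // M.IsPerfectMatching}) {v w : V} (h : G.Adj v w) :
    (oddFactorEquiv hT M).1.Adj v w ↔ M.1.Adj (port T h) (port T h.symm) :=
  trace_adj (L := M.1.spanningCoe) h

open Classical in
/-- The adjacency matrix of a graph on `V`, as a function of two vertices. -/
noncomputable def adjFun (H : SimpleGraph V) (v w : V) : ℚ := if H.Adj v w then 1 else 0

/-- Linear independence of the perfect matchings can be tested on the edges of `G`. -/
theorem linearIndependent_incidenceVector (hT : ∀ v ∈ T, (G.neighborSet v).ncard = 3)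
    (h : LinearIndependent ℚ fun H : {H : SimpleGraph V // IsOddFactor G T H} => adjFun H.1) :
    LinearIndependent ℚ
      fun (M : {M : (triangleInsertion G T).Subgraph // M.IsPerfectMatching})
        (e : (triangleInsertion G T).edgeSet) =>
          (incidenceVector (triangleInsertion G T) M.1 e : ℚ) := by
  classical
  let φ : ((triangleInsertion G T).edgeSet → ℚ) →ₗ[ℚ] (V → V → ℚ) :=
    { toFun := fun f v w => if h : G.Adj v w then f ⟨s(port T h, port T h.symm), adj_port h⟩ else 0
      map_add' := by
        intro f g
        ext v w
        by_cases h : G.Adj v w <;> simp [h]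
      map_smul' := by
        intro c f
        ext v w
        by_cases h : G.Adj v w <;> simp [h] }
  refine LinearIndependent.of_comp φ ?_
  convert h.comp _ (oddFactorEquiv hT).injective using 1
  ext M v w
  by_cases hvw : G.Adj v w
  · simp [φ, hvw, adjFun, oddFactorEquiv_adj hT M hvw, incidenceVector, Set.indicator]
  · have : ¬ (oddFactorEquiv hT M).1.Adj v w := fun h => hvw ((oddFactorEquiv hT M).2.1 h)
    simp [φ, hvw, adjFun, this]

theorem connected_triangleInsertion (hT : ∀ v ∈ T, (G.neighborSet v).ncard = 3)
    (hG : G.Connected) : (triangleInsertion G T).Connected := by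
  have hsame : ∀ x y : InsertionVertex G T, base x = base y →
      (triangleInsertion G T).Reachable x y := by
    intro x y h
    by_cases hx : base x ∈ T
    · by_cases hxy : x = y
      · rw [hxy]
      · rcases x with v | d
        · exact absurd hx v.2
        · rcases y with w | e
          · rw [h] at hx
            exact absurd hx w.2
          · exact SimpleGraph.Adj.reachable (Or.inl ⟨h, by simpa using hxy⟩)
    · rw [eq_of_base_eq_of_notMem h hx]
  have hsurj : ∀ v, ∃ x : InsertionVertex G T, base x = v := by
    intro v
    by_cases hv : v ∈ T
    · obtain ⟨a, ha⟩ : (G.neighborSet v).Nonempty := by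
        rw [Set.nonempty_iff_ne_empty]
        intro h
        simpa [h] using hT v hv
      exact ⟨port T ha, base_port ha⟩
    · exact ⟨.inl ⟨v, hv⟩, rfl⟩
  obtain ⟨v₀⟩ := hG.nonempty
  obtain ⟨x₀, hx₀⟩ := hsurj v₀
  rw [SimpleGraph.connected_iff_exists_forall_reachable]
  refine ⟨x₀, fun y => ?_⟩
  refine forall_of_connected (p := fun v => ∀ y : InsertionVertex G T, base y = v →
    (triangleInsertion G T).Reachable x₀ y) hG ?_ (a := v₀) ?_ (base y) y rfl
  · intro v w h hv y hy
    exact ((hv (port T h) (base_port h)).trans (adj_port h).reachable).trans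
      (hsame _ _ ((base_port h.symm).trans hy.symm))
  · intro y hy
    exact hsame _ _ (hx₀.trans hy.symm)

/-- Triangle-insertions keep a graph matching covered: a perfect matching of `G` through `vw`
extends to one through the edge stemming from `vw` and the edge of the triangle at `v` opposite to
it. -/
theorem isMatchingCovered_triangleInsertion (hT : ∀ v ∈ T, (G.neighborSet v).ncard = 3)
    (hnt : Nontrivial (InsertionVertex G T)) (hG : G.Connected)
    (hcov : ∀ v w, G.Adj v w → ∃ H ≤ G, (∀ u, ∃! z, H.Adj u z) ∧ H.Adj v w) :
    IsMatchingCovered (triangleInsertion G T) := by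
  refine ⟨hnt, connected_triangleInsertion hT hG, ?_⟩
  have hadj : ∀ x y, (triangleInsertion G T).Adj x y →
      ∃ H, IsOddFactor G T H ∧ (lift T H).Adj x y := by
    intro x y hxy
    rcases adj_cases hxy with ⟨v, w, h, rfl, rfl⟩ | ⟨v, a, b, ha, hb, hbT, hab, rfl, rfl⟩
    · obtain ⟨H, hH, hdeg, hvw⟩ := hcov _ _ h
      exact ⟨H, ⟨hH, fun u => Or.inl (hdeg u)⟩, (lift_adj_cross h).2 hvw⟩
    · obtain ⟨c, hac, hbc, hc⟩ : ∃ c, a ≠ c ∧ b ≠ c ∧ G.Adj v c := by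
        obtain ⟨p, q, hap, haq, hpq, hp, hq, hN⟩ := exists_neighbors (hT v hbT) ha
        rcases (hN b).1 hb with rfl | rfl | rfl
        · exact absurd rfl hab
        · exact ⟨q, haq, hpq, hq⟩
        · exact ⟨p, hap, hpq.symm, hp⟩
      obtain ⟨H, hH, hdeg, hvc⟩ := hcov _ _ hc
      refine ⟨H, ⟨hH, fun u => Or.inl (hdeg u)⟩, ?_⟩
      rw [lift_adj_inner hbT ha hb hab]
      exact ⟨fun h => hac ((hdeg v).unique h hvc), fun h => hbc ((hdeg v).unique h hvc)⟩
  intro e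
  induction e using Sym2.ind with
  | _ x y =>
    intro he
    obtain ⟨H, hH, hxy⟩ := hadj x y he
    have hM := ((oddFactorEquiv hT).symm ⟨H, hH⟩).2
    exact ⟨_, hM, hxy⟩

/-- A subgraph of `G` with degree three at `w` and the degrees of an odd factor elsewhere extends to
one of `triangleInsertion G T`. -/
theorem hasTripleFactor_inl (hT : ∀ v ∈ T, (G.neighborSet v).ncard = 3) {w : {v : V // v ∉ T}}
    {H : SimpleGraph V} (hH : H ≤ G) (hw : (H.neighborSet w).ncard = 3)
    (hdeg : ∀ v : V, v ≠ w → (∃! u, H.Adj v u) ∨ (v ∈ T ∧ ∀ u, G.Adj v u → H.Adj v u)) :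
    HasTripleFactor (triangleInsertion G T) (.inl w) := by
  refine ⟨lift T H, lift_le H, ?_, ?_⟩
  · rw [ncard_neighborSet_inl (lift_le H), trace_lift hH, hw]
  · rintro (v | d) hne
    · rw [ncard_neighborSet_inl (lift_le H), trace_lift hH, ← existsUnique_adj_iff_ncard]
      exact (hdeg v (by simpa [Subtype.ext_iff] using hne)).resolve_right fun h => v.2 h.1
    · rw [← existsUnique_adj_iff_ncard]
      refine existsUnique_lift_adj_inr hT hH (fun v hv => ?_) d
      exact (hdeg v fun h => w.2 (h ▸ hv)).imp_right fun h => h.2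

theorem exists_triangle_inr (hT : ∀ v ∈ T, (G.neighborSet v).ncard = 3)
    (d : {d : G.Dart // d.fst ∈ T}) : ∃ x y, (triangleInsertion G T).Adj (.inr d) x ∧
      (triangleInsertion G T).Adj (.inr d) y ∧ (triangleInsertion G T).Adj x y := by
  obtain ⟨⟨⟨v, a⟩, ha⟩, hv⟩ := d
  obtain ⟨b, c, hab, hac, hbc, hb, hc, -⟩ := exists_neighbors (hT v hv) ha
  rw [← port_of_mem ha hv]
  exact ⟨port T hb, port T hc, adj_port_port hv ha hb hab, adj_port_port hv ha hc hac,
    adj_port_port hv hb hc hbc⟩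

theorem ncard_neighborSet_inr (hT : ∀ v ∈ T, (G.neighborSet v).ncard = 3)
    (d : {d : G.Dart // d.fst ∈ T}) :
    ((triangleInsertion G T).neighborSet (.inr d)).ncard = 3 := by
  obtain ⟨⟨⟨v, a⟩, ha⟩, hv⟩ := d
  obtain ⟨b, c, hab, hac, hbc, hb, hc, hN⟩ := exists_neighbors (hT v hv) ha
  rw [← port_of_mem ha hv, Set.ncard_eq_three]
  refine ⟨port T ha.symm, port T hb, port T hc, ?_, ?_, fun h => hbc (port_injective hv hb hc h),
    ?_⟩
  · exact fun h => ha.ne (by simpa using (congrArg base h).symm)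
  · exact fun h => ha.ne (by simpa using (congrArg base h).symm)
  · ext y
    simp only [mem_neighborSet, Set.mem_insert_iff, Set.mem_singleton_iff]
    refine ⟨eq_of_adj_port hv hN ha hb hc, ?_⟩
    rintro (rfl | rfl | rfl)
    · exact adj_port ha
    · exact adj_port_port hv ha hb hab
    · exact adj_port_port hv ha hc hac

theorem card_darts [Finite V] (hT : ∀ v ∈ T, (G.neighborSet v).ncard = 3) :
    Nat.card {d : G.Dart // d.fst ∈ T} = 3 * T.ncard := by
  classical
  have := Fintype.ofFinite V
  let e : {d : G.Dart // d.fst ∈ T} ≃ Σ v : T, G.neighborSet v.1 :=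
    { toFun := fun d => ⟨⟨d.1.fst, d.2⟩, ⟨d.1.snd, d.1.adj⟩⟩
      invFun := fun p => ⟨⟨(p.1.1, p.2.1), p.2.2⟩, p.1.2⟩
      left_inv := fun _ => rfl
      right_inv := fun _ => rfl }
  rw [Nat.card_congr e, Nat.card_sigma]
  have : ∀ v : T, Nat.card (G.neighborSet v.1) = 3 := fun v => hT v.1 v.2
  simp only [this, Finset.sum_const, smul_eq_mul, Finset.card_univ]
  rw [mul_comm, ← Nat.card_eq_fintype_card, Nat.card_coe_set_eq]

instance finite_dart [Finite V] : Finite G.Dart :=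
  Finite.of_injective _ Dart.toProd_injective

/-- Each triangle-insertion adds two vertices. -/
theorem card_insertionVertex [Finite V] (hT : ∀ v ∈ T, (G.neighborSet v).ncard = 3) :
    Nat.card (InsertionVertex G T) = Nat.card V + 2 * T.ncard := by
  have h1 : Nat.card {v : V // v ∉ T} + T.ncard = Nat.card V := by
    rw [add_comm, ← Set.ncard_add_ncard_compl T]
    rfl
  rw [Nat.card_sum, card_darts hT]
  omega

open Classical in
theorem two_mul_ncard_edgeSet {α : Type*} [Fintype α] (H : SimpleGraph α) :
    2 * H.edgeSet.ncard = ∑ v, (H.neighborSet v).ncard := by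
  rw [Set.ncard_eq_toFinset_card', ← edgeFinset, ← sum_degrees_eq_twice_card_edges]
  refine Finset.sum_congr rfl fun v _ => ?_
  rw [Set.ncard_eq_toFinset_card', Set.toFinset_card, card_neighborSet_eq_degree]

/-- Each triangle-insertion adds three edges. -/
theorem ncard_edgeSet_triangleInsertion [Finite V] (hT : ∀ v ∈ T, (G.neighborSet v).ncard = 3) :
    (triangleInsertion G T).edgeSet.ncard = G.edgeSet.ncard + 3 * T.ncard := by
  classical
  have := Fintype.ofFinite V
  have h1 := two_mul_ncard_edgeSet (triangleInsertion G T)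
  rw [Fintype.sum_sum_type] at h1
  simp only [ncard_neighborSet_inr hT, ncard_neighborSet_inl le_rfl,
    trace_triangleInsertion] at h1
  have h2 := two_mul_ncard_edgeSet G
  rw [← Fintype.sum_subtype_add_sum_subtype (fun v => v ∉ T)] at h2
  have h3 : ∑ v : {v // ¬ v ∉ T}, (G.neighborSet v.1).ncard = 3 * T.ncard := by
    rw [Finset.sum_congr rfl fun v _ => hT v.1 (not_not.1 v.2)]
    simp only [Finset.sum_const, smul_eq_mul, Finset.card_univ, not_not]
    rw [mul_comm, ← Nat.card_eq_fintype_card, Nat.card_coe_set_eq]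
  rw [Finset.sum_const, Finset.card_univ, ← Nat.card_eq_fintype_card, card_darts hT,
    smul_eq_mul] at h1
  omega

end Insertion

/-! ### The edges of `G'_t` -/

section PrimeGraph

variable {t : ℕ}

/-- The vertex of `G'_t` at position `j` on the path `s`. -/
abbrev pv (s : Fin (t + 1)) (j : Fin 4) : Option (PathVertex t) := some (some (s, j))

/-- The vertex `u` of `G'_t`. -/
abbrev tip : Option (PathVertex t) := some none

/-- Names for the edges of `G'_t`. The edges `a s` and `b s` with `0 < s < t + 1` lead from the
path `s - 1` to the path `s`; those with `s = 0` come from `u'`, those with `s = t + 1` lead to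
`u`. The edges `e1 s`, `e2 s`, `e3 s` form the path `s`, and `c2 s`, `c4 s`, `cu` join `u'` to the
second and fourth vertex of the path `s` and to `u`. -/
inductive Edge (t : ℕ) : Type
  | a (s : Fin (t + 2))
  | b (s : Fin (t + 2))
  | e1 (s : Fin (t + 1))
  | e2 (s : Fin (t + 1))
  | e3 (s : Fin (t + 1))
  | c2 (s : Fin (t + 1))
  | c4 (s : Fin (t + 1))
  | cu

/-- The end of an edge `a s` or `b s` on the side of the path `s - 1`, where edges leave the paths at
position `j`; it is `u'` for `s = 0`. -/
def lo (j : Fin 4) (s : Fin (t + 2)) : Option (PathVertex t) :=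
  Fin.cases none (fun r => pv r j) s

/-- The end of an edge `a s` or `b s` on the side of the path `s`, where edges enter the paths at
position `j`; it is `u` for `s = t + 1`. -/
def hi (j : Fin 4) (s : Fin (t + 2)) : Option (PathVertex t) :=
  Fin.lastCases tip (fun r => pv r j) s

theorem lo_eq_pv {j i : Fin 4} {s : Fin (t + 2)} {r : Fin (t + 1)} :
    lo j s = pv r i ↔ i = j ∧ s = r.succ := by
  cases s using Fin.cases with
  | zero => simp [lo, (Fin.succ_ne_zero r).symm]
  | succ s => simp [lo, and_comm, eq_comm]

theorem lo_eq_none {j : Fin 4} {s : Fin (t + 2)} : lo j s = none ↔ s = 0 := by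
  cases s using Fin.cases <;> simp [lo]

theorem lo_ne_tip {j : Fin 4} {s : Fin (t + 2)} : lo j s ≠ tip := by
  cases s using Fin.cases <;> simp [lo]

theorem hi_eq_pv {j i : Fin 4} {s : Fin (t + 2)} {r : Fin (t + 1)} :
    hi j s = pv r i ↔ i = j ∧ s = r.castSucc := by
  cases s using Fin.lastCases with
  | last => simp [hi, (Fin.castSucc_lt_last r).ne']
  | cast s => simp [hi, and_comm, eq_comm]

theorem hi_ne_none {j : Fin 4} {s : Fin (t + 2)} : hi j s ≠ none := by
  cases s using Fin.lastCases <;> simp [hi]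

theorem hi_eq_tip {j : Fin 4} {s : Fin (t + 2)} : hi j s = tip ↔ s = Fin.last (t + 1) := by
  cases s using Fin.lastCases with
  | last => simp [hi]
  | cast s => simp [hi, (Fin.castSucc_lt_last s).ne]

/-- One end of an edge of `G'_t`. -/
def src : Edge t → Option (PathVertex t)
  | .a s => lo 0 s
  | .b s => lo 3 s
  | .e1 s => pv s 0
  | .e2 s => pv s 1
  | .e3 s => pv s 2
  | .c2 _ => none
  | .c4 _ => none
  | .cu => none

/-- The other end of an edge of `G'_t`. -/
def tgt : Edge t → Option (PathVertex t)
  | .a s => hi 0 s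
  | .b s => hi 2 s
  | .e1 s => pv s 1
  | .e2 s => pv s 2
  | .e3 s => pv s 3
  | .c2 s => pv s 1
  | .c4 s => pv s 3
  | .cu => tip

theorem primeGraph_adj_none {v : PathVertex t} : (primeGraph t).Adj none (some v) ↔ v ∈ S t :=
  Iff.rfl

theorem primeGraph_adj_some {v w : PathVertex t} :
    (primeGraph t).Adj (some v) (some w) ↔ v ≠ w ∧ (pathRel t v w ∨ pathRel t w v) := by
  show (pathGraph t).Adj v w ↔ _
  rw [pathGraph, SimpleGraph.fromRel_adj]

theorem adj_src_tgt (l : Edge t) : (primeGraph t).Adj (src l) (tgt l) := by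
  cases l with
  | a s =>
    cases s using Fin.cases with
    | zero =>
      show (primeGraph t).Adj none (hi 0 (0 : Fin (t + 1)).castSucc)
      rw [hi, Fin.lastCases_castSucc, primeGraph_adj_none]
      simp [S]
    | succ s =>
      show (primeGraph t).Adj (pv s 0) _
      cases s using Fin.lastCases with
      | last =>
        show (primeGraph t).Adj _ (hi 0 (Fin.last (t + 1)))
        rw [hi, Fin.lastCases_last, primeGraph_adj_some]
        simp [pathRel]
      | cast s =>
        simp only [tgt]
        rw [Fin.succ_castSucc, hi, Fin.lastCases_castSucc, primeGraph_adj_some]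
        simp [pathRel, Fin.ext_iff]
  | b s =>
    cases s using Fin.cases with
    | zero =>
      show (primeGraph t).Adj none (hi 2 (0 : Fin (t + 1)).castSucc)
      rw [hi, Fin.lastCases_castSucc, primeGraph_adj_none]
      simp [S]
    | succ s =>
      show (primeGraph t).Adj (pv s 3) _
      cases s using Fin.lastCases with
      | last =>
        show (primeGraph t).Adj _ (hi 2 (Fin.last (t + 1)))
        rw [hi, Fin.lastCases_last, primeGraph_adj_some]
        simp [pathRel]
      | cast s =>
        simp only [tgt]
        rw [Fin.succ_castSucc, hi, Fin.lastCases_castSucc, primeGraph_adj_some]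
        simp [pathRel, Fin.ext_iff]
  | e1 s => simp [src, tgt, primeGraph_adj_some, pathRel]
  | e2 s => simp [src, tgt, primeGraph_adj_some, pathRel]
  | e3 s => simp [src, tgt, primeGraph_adj_some, pathRel]
  | c2 s => simp [src, tgt, primeGraph_adj_none, S]
  | c4 s => simp [src, tgt, primeGraph_adj_none, S]
  | cu => simp [src, tgt, primeGraph_adj_none, S]

/-- The edge of `G'_t` with a given name. -/
def ends (l : Edge t) : Sym2 (Option (PathVertex t)) := s(src l, tgt l)

theorem ends_eq_pv_zero {l : Edge t} {s : Fin (t + 1)} {w : Option (PathVertex t)} :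
    ends l = s(pv s 0, w) ↔ (l = .a s.castSucc ∧ w = lo 0 s.castSucc) ∨
      (l = .a s.succ ∧ w = hi 0 s.succ) ∨ (l = .e1 s ∧ w = pv s 1) := by
  cases l <;> simp [ends, src, tgt, lo_eq_pv, hi_eq_pv] <;> grind

theorem ends_eq_pv_one {l : Edge t} {s : Fin (t + 1)} {w : Option (PathVertex t)} :
    ends l = s(pv s 1, w) ↔ (l = .c2 s ∧ w = none) ∨ (l = .e1 s ∧ w = pv s 0) ∨
      (l = .e2 s ∧ w = pv s 2) := by
  cases l <;> simp [ends, src, tgt, lo_eq_pv, hi_eq_pv] <;> grind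

theorem ends_eq_pv_two {l : Edge t} {s : Fin (t + 1)} {w : Option (PathVertex t)} :
    ends l = s(pv s 2, w) ↔ (l = .b s.castSucc ∧ w = lo 3 s.castSucc) ∨
      (l = .e2 s ∧ w = pv s 1) ∨ (l = .e3 s ∧ w = pv s 3) := by
  cases l <;> simp [ends, src, tgt, lo_eq_pv, hi_eq_pv] <;> grind

theorem ends_eq_pv_three {l : Edge t} {s : Fin (t + 1)} {w : Option (PathVertex t)} :
    ends l = s(pv s 3, w) ↔ (l = .c4 s ∧ w = none) ∨ (l = .e3 s ∧ w = pv s 2) ∨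
      (l = .b s.succ ∧ w = hi 2 s.succ) := by
  cases l <;> simp [ends, src, tgt, lo_eq_pv, hi_eq_pv] <;> grind

theorem ends_eq_tip {l : Edge t} {w : Option (PathVertex t)} :
    ends l = s(tip, w) ↔ (l = .cu ∧ w = none) ∨ (l = .a (Fin.last _) ∧ w = lo 0 (Fin.last _)) ∨
      (l = .b (Fin.last _) ∧ w = lo 3 (Fin.last _)) := by
  cases l <;> simp [ends, src, tgt, lo_ne_tip, hi_eq_tip] <;> grind

/-- Names for the neighbours of `u'` in `G'_t`: the first and third vertex of the path `0`, the
second and fourth vertex of each path, and `u`. -/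
inductive Spoke (t : ℕ) : Type
  | first
  | third
  | two (s : Fin (t + 1))
  | four (s : Fin (t + 1))
  | last

/-- The neighbour of `u'` with a given name. -/
def spokeEnd : Spoke t → Option (PathVertex t)
  | .first => pv 0 0
  | .third => pv 0 2
  | .two s => pv s 1
  | .four s => pv s 3
  | .last => tip

/-- The edge from `u'` to a given neighbour. -/
def spokeEdge : Spoke t → Edge t
  | .first => .a 0
  | .third => .b 0
  | .two s => .c2 s
  | .four s => .c4 s
  | .last => .cu

theorem spokeEnd_injective : Function.Injective (spokeEnd (t := t)) := by
  rintro (_ | _ | s | s | _) (_ | _ | r | r | _) h <;> simp_all [spokeEnd]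

theorem ends_eq_none {l : Edge t} {w : Option (PathVertex t)} :
    ends l = s(none, w) ↔ ∃ x, l = spokeEdge x ∧ w = spokeEnd x := by
  have h0 : ∀ j : Fin 4, hi j (0 : Fin (t + 2)) = pv 0 j := fun j => hi_eq_pv.2 ⟨rfl, rfl⟩
  constructor
  · intro h
    rcases Sym2.eq_iff.1 h with ⟨h1, h2⟩ | ⟨h1, h2⟩
    · cases l with
      | a s =>
        obtain rfl := lo_eq_none.1 h1
        exact ⟨.first, rfl, h2.symm.trans (h0 0)⟩
      | b s =>
        obtain rfl := lo_eq_none.1 h1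
        exact ⟨.third, rfl, h2.symm.trans (h0 2)⟩
      | c2 s => exact ⟨.two s, rfl, h2.symm⟩
      | c4 s => exact ⟨.four s, rfl, h2.symm⟩
      | cu => exact ⟨.last, rfl, h2.symm⟩
      | _ => simp [src] at h1
    · cases l with
      | a s => exact absurd h2 hi_ne_none
      | b s => exact absurd h2 hi_ne_none
      | _ => simp [tgt] at h2
  · rintro ⟨x, rfl, rfl⟩
    cases x with
    | first => simp [ends, src, tgt, spokeEdge, spokeEnd, h0, lo]
    | third => simp [ends, src, tgt, spokeEdge, spokeEnd, h0, lo]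
    | _ => rfl

theorem ends_spokeEdge (x : Spoke t) : ends (spokeEdge x) = s(none, spokeEnd x) :=
  ends_eq_none.2 ⟨x, rfl, rfl⟩

theorem range_spokeEnd : Set.range (spokeEnd (t := t)) = some '' S t := by
  ext v
  constructor
  · rintro ⟨(_ | _ | s | s | _), rfl⟩
    · exact ⟨some (0, 0), by simp [S], rfl⟩
    · exact ⟨some (0, 2), by simp [S], rfl⟩
    · exact ⟨some (s, 1), by simp [S], rfl⟩
    · exact ⟨some (s, 3), by simp [S], rfl⟩
    · exact ⟨none, by simp [S], rfl⟩
  · rintro ⟨v, ((rfl | rfl | rfl) | ⟨s, rfl | rfl⟩), rfl⟩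
    · exact ⟨.first, rfl⟩
    · exact ⟨.third, rfl⟩
    · exact ⟨.last, rfl⟩
    · exact ⟨.two s, rfl⟩
    · exact ⟨.four s, rfl⟩

theorem exists_ends_eq_of_pathRel {v w : PathVertex t} (h : pathRel t v w) :
    ∃ l : Edge t, ends l = s(some v, some w) := by
  rcases v with _ | ⟨s, j⟩ <;> rcases w with _ | ⟨s', j'⟩
  · exact h.elim
  · obtain ⟨rfl, rfl | rfl⟩ := h
    · exact ⟨.a (Fin.last _), ends_eq_tip.2 (Or.inr (Or.inl ⟨rfl, (lo_eq_pv.2 ⟨rfl, rfl⟩).symm⟩))⟩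
    · exact ⟨.b (Fin.last _), ends_eq_tip.2 (Or.inr (Or.inr ⟨rfl, (lo_eq_pv.2 ⟨rfl, rfl⟩).symm⟩))⟩
  · exact h.elim
  · rcases h with ⟨rfl, h⟩ | ⟨h, ⟨rfl, rfl⟩ | ⟨rfl, rfl⟩⟩
    · fin_cases j
      · obtain rfl : j' = 1 := Fin.ext h
        exact ⟨.e1 s', rfl⟩
      · obtain rfl : j' = 2 := Fin.ext h
        exact ⟨.e2 s', rfl⟩
      · obtain rfl : j' = 3 := Fin.ext h
        exact ⟨.e3 s', rfl⟩
      · have := j'.2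
        simp at h
        omega
    · have hs : s.succ = s'.castSucc := Fin.ext (by simp [h])
      exact ⟨.a s.succ, ends_eq_pv_zero.2 (Or.inr (Or.inl ⟨rfl, (hi_eq_pv.2 ⟨rfl, hs⟩).symm⟩))⟩
    · have hs : s.succ = s'.castSucc := Fin.ext (by simp [h])
      exact ⟨.b s.succ, ends_eq_pv_three.2 (Or.inr (Or.inr ⟨rfl, (hi_eq_pv.2 ⟨rfl, hs⟩).symm⟩))⟩

theorem primeGraph_adj_iff {v w : Option (PathVertex t)} :
    (primeGraph t).Adj v w ↔ ∃ l : Edge t, ends l = s(v, w) := by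
  constructor
  · intro h
    have hnone : ∀ x : PathVertex t, x ∈ S t → ∃ l : Edge t, ends l = s(none, some x) := by
      intro x hx
      obtain ⟨y, hy⟩ : some x ∈ Set.range (spokeEnd (t := t)) := by
        rw [range_spokeEnd]
        exact ⟨x, hx, rfl⟩
      exact ⟨spokeEdge y, hy ▸ ends_spokeEdge y⟩
    rcases v with _ | v <;> rcases w with _ | w
    · exact h.elim
    · exact hnone w h
    · rw [Sym2.eq_swap]
      exact hnone v h
    · rcases (primeGraph_adj_some.1 h).2 with h | h
      · exact exists_ends_eq_of_pathRel h
      · rw [Sym2.eq_swap]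
        exact exists_ends_eq_of_pathRel h
  · rintro ⟨l, h⟩
    have := adj_src_tgt l
    rcases Sym2.eq_iff.1 h with ⟨h1, h2⟩ | ⟨h1, h2⟩
    · rwa [← h1, ← h2]
    · rw [← h1, ← h2]
      exact this.symm

theorem nbr_pv_zero (s : Fin (t + 1)) (w : Option (PathVertex t)) :
    (primeGraph t).Adj (pv s 0) w ↔ w = lo 0 s.castSucc ∨ w = hi 0 s.succ ∨ w = pv s 1 := by
  simp [primeGraph_adj_iff, ends_eq_pv_zero, exists_or]

theorem nbr_pv_one (s : Fin (t + 1)) (w : Option (PathVertex t)) :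
    (primeGraph t).Adj (pv s 1) w ↔ w = none ∨ w = pv s 0 ∨ w = pv s 2 := by
  simp [primeGraph_adj_iff, ends_eq_pv_one, exists_or]

theorem nbr_pv_two (s : Fin (t + 1)) (w : Option (PathVertex t)) :
    (primeGraph t).Adj (pv s 2) w ↔ w = lo 3 s.castSucc ∨ w = pv s 1 ∨ w = pv s 3 := by
  simp [primeGraph_adj_iff, ends_eq_pv_two, exists_or]

theorem nbr_pv_three (s : Fin (t + 1)) (w : Option (PathVertex t)) :
    (primeGraph t).Adj (pv s 3) w ↔ w = none ∨ w = pv s 2 ∨ w = hi 2 s.succ := by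
  simp [primeGraph_adj_iff, ends_eq_pv_three, exists_or]

theorem nbr_tip (w : Option (PathVertex t)) :
    (primeGraph t).Adj tip w ↔ w = none ∨ w = lo 0 (Fin.last _) ∨ w = lo 3 (Fin.last _) := by
  simp [primeGraph_adj_iff, ends_eq_tip, exists_or]

theorem nbr_none (w : Option (PathVertex t)) :
    (primeGraph t).Adj none w ↔ ∃ x, w = spokeEnd x := by
  simp [primeGraph_adj_iff, ends_eq_none]

theorem lo_ne_hi (i j : Fin 4) (s : Fin (t + 1)) : lo i s.castSucc ≠ hi j s.succ := by
  cases s using Fin.cases with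
  | zero => simpa [lo] using hi_ne_none.symm
  | succ s =>
    rw [← Fin.succ_castSucc, lo, Fin.cases_succ]
    intro h
    have := (hi_eq_pv.1 h.symm).2
    simp [Fin.ext_iff] at this
    omega

theorem lo_ne_pv (i j : Fin 4) (s : Fin (t + 1)) : lo i s.castSucc ≠ pv s j := by
  rw [Ne, lo_eq_pv]
  simp [Fin.ext_iff]

theorem hi_ne_pv (i j : Fin 4) (s : Fin (t + 1)) : hi i s.succ ≠ pv s j := by
  rw [Ne, hi_eq_pv]
  simp [Fin.ext_iff]

theorem lo_last (j : Fin 4) : lo j (Fin.last (t + 1)) = pv (Fin.last t) j :=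
  lo_eq_pv.2 ⟨rfl, rfl⟩

/-- `G'_t` has no two names for the same edge. -/
theorem ends_unique {v w : Option (PathVertex t)} {l l' : Edge t} (h : ends l = s(v, w))
    (h' : ends l' = s(v, w)) : l = l' := by
  have h1 := lo_ne_hi (t := t)
  have h2 := lo_ne_pv (t := t)
  have h3 := hi_ne_pv (t := t)
  have h4 := fun (j : Fin 4) (s : Fin (t + 2)) => hi_ne_none (j := j) (s := s)
  rcases v with _ | _ | ⟨s, j⟩
  · rw [ends_eq_none] at h h'
    obtain ⟨x, rfl, hx⟩ := h
    obtain ⟨y, rfl, hy⟩ := h'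
    rw [spokeEnd_injective (hx.symm.trans hy)]
  · rw [ends_eq_tip, lo_last, lo_last] at h h'
    rcases h with ⟨rfl, rfl⟩ | ⟨rfl, rfl⟩ | ⟨rfl, rfl⟩ <;> simp at h' <;> exact h'.symm
  · fin_cases j
    · have h := ends_eq_pv_zero.1 h
      have h' := ends_eq_pv_zero.1 h'
      grind
    · have h := ends_eq_pv_one.1 h
      have h' := ends_eq_pv_one.1 h'
      rcases h with ⟨rfl, rfl⟩ | ⟨rfl, rfl⟩ | ⟨rfl, rfl⟩ <;> simp at h' <;> exact h'.symm
    · have h := ends_eq_pv_two.1 h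
      have h' := ends_eq_pv_two.1 h'
      rcases h with ⟨rfl, rfl⟩ | ⟨rfl, rfl⟩ | ⟨rfl, rfl⟩ <;> grind
    · have h := ends_eq_pv_three.1 h
      have h' := ends_eq_pv_three.1 h'
      grind

/-- The subgraph of `G'_t` formed by the edges whose names satisfy `f`. -/
def graphOf (f : Edge t → Prop) : SimpleGraph (Option (PathVertex t)) where
  Adj v w := ∃ l, f l ∧ ends l = s(v, w)
  symm := ⟨fun _ _ ⟨l, hl, h⟩ => ⟨l, hl, h.trans Sym2.eq_swap⟩⟩
  loopless := ⟨fun _ ⟨_, _, h⟩ => (primeGraph t).loopless.irrefl _ (primeGraph_adj_iff.2 ⟨_, h⟩)⟩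

theorem graphOf_le (f : Edge t → Prop) : graphOf f ≤ primeGraph t :=
  fun _ _ ⟨l, _, h⟩ => primeGraph_adj_iff.2 ⟨l, h⟩

theorem graphOf_adj {f : Edge t → Prop} {l : Edge t} {v w : Option (PathVertex t)}
    (h : ends l = s(v, w)) : (graphOf f).Adj v w ↔ f l :=
  ⟨fun ⟨_, hl, h'⟩ => ends_unique h h' ▸ hl, fun hl => ⟨l, hl, h⟩⟩

theorem exists_eq_graphOf {H : SimpleGraph (Option (PathVertex t))} (hH : H ≤ primeGraph t) :
    ∃ f : Edge t → Prop, H = graphOf f := by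
  refine ⟨fun l => H.Adj (src l) (tgt l), ?_⟩
  ext v w
  constructor
  · intro h
    obtain ⟨l, hl⟩ := primeGraph_adj_iff.1 (hH h)
    refine ⟨l, ?_, hl⟩
    rcases Sym2.eq_iff.1 hl with ⟨rfl, rfl⟩ | ⟨rfl, rfl⟩
    · exact h
    · exact h.symm
  · rintro ⟨l, h, hl⟩
    rcases Sym2.eq_iff.1 hl with ⟨rfl, rfl⟩ | ⟨rfl, rfl⟩
    · exact h
    · exact h.symm

/-- Exactly one of three propositions holds or, if `v ∈ T`, all of them do. -/
def OneOrAll {α : Type*} (T : Set α) (v : α) (p q r : Prop) : Prop :=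
  ExactlyOne p q r ∨ (v ∈ T ∧ p ∧ q ∧ r)

/-- The degree conditions of `IsOddFactor` at a vertex of degree three. -/
theorem oneOrAll_iff {f : Edge t → Prop} {T : Set (Option (PathVertex t))}
    {v x y z : Option (PathVertex t)} {l₁ l₂ l₃ : Edge t} (hxy : x ≠ y) (hxz : x ≠ z) (hyz : y ≠ z)
    (hN : ∀ w, (primeGraph t).Adj v w ↔ w = x ∨ w = y ∨ w = z)
    (h₁ : ends l₁ = s(v, x)) (h₂ : ends l₂ = s(v, y)) (h₃ : ends l₃ = s(v, z)) :
    ((∃! w, (graphOf f).Adj v w) ∨ (v ∈ T ∧ ∀ w, (primeGraph t).Adj v w → (graphOf f).Adj v w)) ↔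
      OneOrAll T v (f l₁) (f l₂) (f l₃) := by
  rw [existsUnique_adj_iff (graphOf_le f) hxy hxz hyz hN]
  simp only [hN, forall_eq_or_imp, forall_eq, graphOf_adj h₁, graphOf_adj h₂, graphOf_adj h₃,
    OneOrAll]

/-- The degree conditions of `IsOddFactor` for `graphOf f` at the vertices other than `u'`. -/
structure IsOddOffHub (T : Set (Option (PathVertex t))) (f : Edge t → Prop) : Prop where
  zero : ∀ s, OneOrAll T (pv s 0) (f (.a s.castSucc)) (f (.a s.succ)) (f (.e1 s))
  one : ∀ s, OneOrAll T (pv s 1) (f (.c2 s)) (f (.e1 s)) (f (.e2 s))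
  two : ∀ s, OneOrAll T (pv s 2) (f (.b s.castSucc)) (f (.e2 s)) (f (.e3 s))
  three : ∀ s, OneOrAll T (pv s 3) (f (.c4 s)) (f (.e3 s)) (f (.b s.succ))
  tip : OneOrAll T tip (f .cu) (f (.a (Fin.last _))) (f (.b (Fin.last _)))

/-- The condition `IsOddFactor` for `graphOf f`, spelled out at each vertex. -/
structure IsOdd (T : Set (Option (PathVertex t))) (f : Edge t → Prop) : Prop
    extends IsOddOffHub T f where
  hub : ∃! x, f (spokeEdge x)

theorem existsUnique_graphOf_adj_none {f : Edge t → Prop} :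
    (∃! w, (graphOf f).Adj none w) ↔ ∃! x, f (spokeEdge x) := by
  constructor
  · rintro ⟨w, hw, hu⟩
    obtain ⟨x, rfl⟩ := (nbr_none w).1 (graphOf_le f hw)
    refine ⟨x, (graphOf_adj (ends_spokeEdge x)).1 hw, fun y hy => ?_⟩
    exact spokeEnd_injective (hu _ ((graphOf_adj (ends_spokeEdge y)).2 hy))
  · rintro ⟨x, hx, hu⟩
    refine ⟨spokeEnd x, (graphOf_adj (ends_spokeEdge x)).2 hx, fun w hw => ?_⟩
    obtain ⟨y, rfl⟩ := (nbr_none w).1 (graphOf_le f hw)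
    rw [hu y ((graphOf_adj (ends_spokeEdge y)).1 hw)]

section Conditions

variable {T : Set (Option (PathVertex t))} {f : Edge t → Prop}

theorem oneOrAll_zero (s : Fin (t + 1)) :
    ((∃! w, (graphOf f).Adj (pv s 0) w) ∨
      (pv s 0 ∈ T ∧ ∀ w, (primeGraph t).Adj (pv s 0) w → (graphOf f).Adj (pv s 0) w)) ↔
      OneOrAll T (pv s 0) (f (.a s.castSucc)) (f (.a s.succ)) (f (.e1 s)) :=
  oneOrAll_iff (lo_ne_hi _ _ _) (lo_ne_pv _ _ _) (hi_ne_pv _ _ _) (nbr_pv_zero s)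
    (by simp [ends_eq_pv_zero]) (by simp [ends_eq_pv_zero]) (by simp [ends_eq_pv_zero])

theorem oneOrAll_one (s : Fin (t + 1)) :
    ((∃! w, (graphOf f).Adj (pv s 1) w) ∨
      (pv s 1 ∈ T ∧ ∀ w, (primeGraph t).Adj (pv s 1) w → (graphOf f).Adj (pv s 1) w)) ↔
      OneOrAll T (pv s 1) (f (.c2 s)) (f (.e1 s)) (f (.e2 s)) :=
  oneOrAll_iff (by simp) (by simp) (by simp) (nbr_pv_one s)
    (by simp [ends_eq_pv_one]) (by simp [ends_eq_pv_one]) (by simp [ends_eq_pv_one])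

theorem oneOrAll_two (s : Fin (t + 1)) :
    ((∃! w, (graphOf f).Adj (pv s 2) w) ∨
      (pv s 2 ∈ T ∧ ∀ w, (primeGraph t).Adj (pv s 2) w → (graphOf f).Adj (pv s 2) w)) ↔
      OneOrAll T (pv s 2) (f (.b s.castSucc)) (f (.e2 s)) (f (.e3 s)) :=
  oneOrAll_iff (lo_ne_pv _ _ _) (lo_ne_pv _ _ _) (by simp) (nbr_pv_two s)
    (by simp [ends_eq_pv_two]) (by simp [ends_eq_pv_two]) (by simp [ends_eq_pv_two])

theorem oneOrAll_three (s : Fin (t + 1)) :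
    ((∃! w, (graphOf f).Adj (pv s 3) w) ∨
      (pv s 3 ∈ T ∧ ∀ w, (primeGraph t).Adj (pv s 3) w → (graphOf f).Adj (pv s 3) w)) ↔
      OneOrAll T (pv s 3) (f (.c4 s)) (f (.e3 s)) (f (.b s.succ)) :=
  oneOrAll_iff (by simp) hi_ne_none.symm (hi_ne_pv _ _ _).symm (nbr_pv_three s)
    (by simp [ends_eq_pv_three]) (by simp [ends_eq_pv_three]) (by simp [ends_eq_pv_three])

theorem oneOrAll_tip :
    ((∃! w, (graphOf f).Adj tip w) ∨
      (tip ∈ T ∧ ∀ w, (primeGraph t).Adj tip w → (graphOf f).Adj tip w)) ↔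
      OneOrAll T tip (f .cu) (f (.a (Fin.last _))) (f (.b (Fin.last _))) :=
  oneOrAll_iff (by simp [lo_last]) (by simp [lo_last]) (by simp [lo_last]) nbr_tip
    (by simp [ends_eq_tip]) (by simp [ends_eq_tip]) (by simp [ends_eq_tip])

theorem isOddOffHub_iff : IsOddOffHub T f ↔ ∀ v : PathVertex t,
    (∃! w, (graphOf f).Adj (some v) w) ∨
      (some v ∈ T ∧ ∀ w, (primeGraph t).Adj (some v) w → (graphOf f).Adj (some v) w) := by
  constructor
  · rintro h (_ | ⟨s, j⟩)
    · exact oneOrAll_tip.2 h.tip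
    · fin_cases j
      · exact (oneOrAll_zero s).2 (h.zero s)
      · exact (oneOrAll_one s).2 (h.one s)
      · exact (oneOrAll_two s).2 (h.two s)
      · exact (oneOrAll_three s).2 (h.three s)
  · exact fun h => ⟨fun s => (oneOrAll_zero s).1 (h _), fun s => (oneOrAll_one s).1 (h _),
      fun s => (oneOrAll_two s).1 (h _), fun s => (oneOrAll_three s).1 (h _),
      oneOrAll_tip.1 (h _)⟩

/-- The degree conditions of `IsOddFactor` in terms of the names of the edges. -/
theorem isOddFactor_graphOf (hT : none ∉ T) :
    IsOddFactor (primeGraph t) T (graphOf f) ↔ IsOdd T f := by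
  constructor
  · rintro ⟨-, h⟩
    exact ⟨isOddOffHub_iff.2 fun v => h (some v),
      existsUnique_graphOf_adj_none.1 ((h none).resolve_right fun h => hT h.1)⟩
  · intro h
    refine ⟨graphOf_le f, ?_⟩
    rintro (_ | v)
    · exact Or.inl (existsUnique_graphOf_adj_none.2 h.hub)
    · exact isOddOffHub_iff.1 h.toIsOddOffHub v

end Conditions

theorem ncard_neighborSet_some (v : PathVertex t) :
    ((primeGraph t).neighborSet (some v)).ncard = 3 := by
  rw [Set.ncard_eq_three]
  have hext : ∀ {x y z : Option (PathVertex t)}, (∀ w, (primeGraph t).Adj (some v) w ↔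
      w = x ∨ w = y ∨ w = z) → (primeGraph t).neighborSet (some v) = {x, y, z} := by
    intro x y z h
    ext w
    simp [h]
  rcases v with _ | ⟨s, j⟩
  · refine ⟨_, _, _, ?_, ?_, ?_, hext nbr_tip⟩ <;> simp [lo_last]
  · fin_cases j
    · exact ⟨_, _, _, lo_ne_hi _ _ _, lo_ne_pv _ _ _, hi_ne_pv _ _ _, hext (nbr_pv_zero s)⟩
    · exact ⟨_, _, _, by simp, by simp, by simp, hext (nbr_pv_one s)⟩
    · exact ⟨_, _, _, lo_ne_pv _ _ _, lo_ne_pv _ _ _, by simp, hext (nbr_pv_two s)⟩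
    · exact ⟨_, _, _, by simp, hi_ne_none.symm, (hi_ne_pv _ _ _).symm, hext (nbr_pv_three s)⟩

theorem connected_primeGraph (t : ℕ) : (primeGraph t).Connected := by
  rw [SimpleGraph.connected_iff_exists_forall_reachable]
  have h1 : ∀ s, (primeGraph t).Reachable none (pv s 1) := fun s =>
    SimpleGraph.Adj.reachable ((nbr_pv_one s none).2 (by simp)).symm
  refine ⟨none, ?_⟩
  rintro (_ | _ | ⟨s, j⟩)
  · exact SimpleGraph.Reachable.refl _
  · exact SimpleGraph.Adj.reachable ((nbr_tip none).2 (by simp)).symm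
  · fin_cases j
    · exact (h1 s).trans (SimpleGraph.Adj.reachable ((nbr_pv_one s _).2 (by simp)))
    · exact h1 s
    · exact (h1 s).trans (SimpleGraph.Adj.reachable ((nbr_pv_one s _).2 (by simp)))
    · exact SimpleGraph.Adj.reachable ((nbr_pv_three s none).2 (by simp)).symm

/-- The names of the neighbours of `u'` as a sum type, for counting. -/
def spokeEquiv (t : ℕ) : Spoke t ≃ Fin 3 ⊕ (Fin (t + 1) ⊕ Fin (t + 1)) where
  toFun
    | .first => .inl 0
    | .third => .inl 1
    | .last => .inl 2
    | .two s => .inr (.inl s)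
    | .four s => .inr (.inr s)
  invFun
    | .inl 0 => .first
    | .inl 1 => .third
    | .inl 2 => .last
    | .inr (.inl s) => .two s
    | .inr (.inr s) => .four s
  left_inv x := by cases x <;> rfl
  right_inv x := by
    rcases x with x | x | x
    · fin_cases x <;> rfl
    · rfl
    · rfl

instance finite_spoke : Finite (Spoke t) := Finite.of_equiv _ (spokeEquiv t).symm

theorem card_spoke (t : ℕ) : Nat.card (Spoke t) = 2 * t + 5 := by
  rw [Nat.card_congr (spokeEquiv t)]
  simp
  omega

theorem ncard_neighborSet_none : ((primeGraph t).neighborSet none).ncard = 2 * t + 5 := by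
  have : (primeGraph t).neighborSet none = Set.range spokeEnd := by
    ext w
    simp [nbr_none, eq_comm]
  rw [this, ← Set.image_univ, spokeEnd_injective.injOn.ncard_image, Set.ncard_univ, card_spoke]

theorem ncard_edgeSet_primeGraph : (primeGraph t).edgeSet.ncard = 7 * t + 10 := by
  have h := two_mul_ncard_edgeSet (primeGraph t)
  rw [Fintype.sum_option] at h
  simp only [ncard_neighborSet_none, ncard_neighborSet_some, Finset.sum_const, Finset.card_univ,
    Fintype.card_option, Fintype.card_prod, Fintype.card_fin, smul_eq_mul] at h
  omega

end PrimeGraph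

/-! ### Odd factors of `G'_t` -/

section Factors

variable {t : ℕ}

/-- The odd factor in which `u'` is matched to the spoke `x` and all degrees are one. For
`x = two (p + 1)` there is a second one, `factorBeta p`. Matching `u'` into the path `p` leaves
just the edge `a (p + 1)` between the paths `p` and `p + 1`, and then just the edges `b s`. -/
def factorOne : Spoke t → Edge t → Prop
  | .first, .a s => s.val = 0
  | .first, .b s => 1 ≤ s.val
  | .first, .e1 s => s.val ≠ 0
  | .first, .e2 s => s.val = 0
  | .third, .b _ => True
  | .third, .e1 _ => True
  | .two p, .a s => s.val = p.val + 1
  | .two p, .b s => p.val + 2 ≤ s.val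
  | .two p, .e1 s => s.val ≠ p.val ∧ s.val ≠ p.val + 1
  | .two p, .e2 s => s.val = p.val + 1
  | .two p, .e3 s => s.val ≤ p.val
  | .two p, .c2 s => s.val = p.val
  | .four p, .a s => s.val = p.val + 1
  | .four p, .b s => p.val + 2 ≤ s.val
  | .four p, .e1 s => s.val ≠ p.val ∧ s.val ≠ p.val + 1
  | .four p, .e2 s => s.val = p.val ∨ s.val = p.val + 1
  | .four p, .e3 s => s.val < p.val
  | .four p, .c4 s => s.val = p.val
  | .last, .e1 _ => True
  | .last, .e3 _ => True
  | .last, .cu => True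
  | _, _ => False

/-- The odd factor in which `u'` is matched to the spoke `x`, whose degree is three. -/
def factorThree : Spoke t → Edge t → Prop
  | .first, .a s => s.val ≤ 1
  | .first, .b s => 2 ≤ s.val
  | .first, .e1 s => s.val ≠ 1
  | .first, .e2 s => s.val = 1
  | .first, .e3 s => s.val = 0
  | .third, .a s => s.val = 1
  | .third, .b s => s.val ≠ 1
  | .third, .e1 s => 2 ≤ s.val
  | .third, .e2 s => s.val ≤ 1
  | .third, .e3 s => s.val = 0
  | .two p, .b s => p.val + 1 ≤ s.val
  | .two _, .e1 _ => True
  | .two p, .e2 s => s.val = p.val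
  | .two p, .e3 s => s.val < p.val
  | .two p, .c2 s => s.val = p.val
  | .four p, .b s => p.val + 1 ≤ s.val
  | .four _, .e1 _ => True
  | .four p, .e3 s => s.val ≤ p.val
  | .four p, .c4 s => s.val = p.val
  | .last, .a s => s.val = t + 1
  | .last, .b s => s.val = t + 1
  | .last, .e1 s => s.val ≠ t
  | .last, .e2 s => s.val = t
  | .last, .e3 s => s.val ≠ t
  | .last, .cu => True
  | _, _ => False

/-- The odd factor with all degrees one that contains both edges from the path `p` to the path
`p + 1`; in it `u'` is matched to the spoke `two (p + 1)`. -/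
def factorBeta (p : Fin t) : Edge t → Prop
  | .a s => s.val = p.val + 1
  | .b s => p.val + 1 ≤ s.val
  | .e1 s => s.val ≠ p.val ∧ s.val ≠ p.val + 1
  | .e2 s => s.val = p.val
  | .e3 s => s.val < p.val
  | .c2 s => s.val = p.val + 1
  | _ => False

/-- A spanning subgraph with degree three at the first vertex of the path `p + 1`. -/
def tripleZero (p : Fin t) : Edge t → Prop
  | .a s => s.val = p.val + 1 ∨ s.val = p.val + 2
  | .b s => p.val + 3 ≤ s.val
  | .e1 s => s.val ≠ p.val ∧ s.val ≠ p.val + 2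
  | .e2 s => s.val = p.val + 2
  | .e3 s => s.val ≤ p.val + 1
  | .c2 s => s.val = p.val
  | _ => False

/-- A spanning subgraph with degree three at the third vertex of the path `p + 1`. -/
def tripleTwo (p : Fin t) : Edge t → Prop
  | .a s => s.val = p.val + 2
  | .b s => s.val ≠ p.val + 2
  | .e1 s => s.val ≠ p.val + 1 ∧ s.val ≠ p.val + 2
  | .e2 s => s.val = p.val + 1 ∨ s.val = p.val + 2
  | .e3 s => s.val = p.val + 1
  | _ => False

/-- A spanning subgraph with degree three at `u'`. -/
def tripleHub : Edge t → Prop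
  | .a s => s.val = 0
  | .b _ => True
  | .e1 s => s.val ≠ 0
  | .c2 s => s.val = 0
  | _ => False

theorem factorOne_spokeEdge {x y : Spoke t} : factorOne x (spokeEdge y) ↔ y = x := by
  cases x <;> cases y <;>
    simp only [factorOne, spokeEdge, Spoke.two.injEq, Spoke.four.injEq, Fin.val_zero, reduceCtorEq,
      Fin.ext_iff, iff_self, iff_false] <;> omega

theorem factorThree_spokeEdge {x y : Spoke t} : factorThree x (spokeEdge y) ↔ y = x := by
  cases x <;> cases y <;>
    simp only [factorThree, spokeEdge, Spoke.two.injEq, Spoke.four.injEq, Fin.val_zero,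
      reduceCtorEq, Fin.ext_iff, iff_self, iff_true, iff_false] <;> omega

theorem factorBeta_spokeEdge {p : Fin t} {y : Spoke t} :
    factorBeta p (spokeEdge y) ↔ y = .two p.succ := by
  cases y
  all_goals
    simp only [factorBeta, spokeEdge, Spoke.two.injEq, Fin.val_zero, reduceCtorEq, Fin.ext_iff,
      Fin.val_succ, iff_self, iff_false]
  omega

theorem isOdd_factorOne (x : Spoke t) : IsOdd ∅ (factorOne x) := by
  refine ⟨⟨?_, ?_, ?_, ?_, ?_⟩,
    ⟨x, factorOne_spokeEdge.2 rfl, fun y hy => factorOne_spokeEdge.1 hy⟩⟩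
  all_goals
    intros
    cases x <;>
    simp only [OneOrAll, ExactlyOne, factorOne, Fin.val_castSucc, Fin.val_succ, Fin.val_last,
      Set.mem_empty_iff_false, false_and, or_false, true_and, and_true, and_false, false_or,
      not_true_eq_false, not_false_eq_true, and_self] <;> omega

theorem isOdd_factorBeta (p : Fin t) : IsOdd ∅ (factorBeta p) := by
  refine ⟨⟨?_, ?_, ?_, ?_, ?_⟩,
    ⟨_, factorBeta_spokeEdge.2 rfl, fun y hy => factorBeta_spokeEdge.1 hy⟩⟩
  all_goals
    intros
    simp only [OneOrAll, ExactlyOne, factorBeta, Fin.val_castSucc, Fin.val_succ, Fin.val_last,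
      Set.mem_empty_iff_false, false_and, or_false, true_and, false_or,
      not_false_eq_true, and_self]
    omega

theorem isOdd_factorThree (x : Spoke t) : IsOdd {spokeEnd x} (factorThree x) := by
  refine ⟨⟨?_, ?_, ?_, ?_, ?_⟩,
    ⟨x, factorThree_spokeEdge.2 rfl, fun y hy => factorThree_spokeEdge.1 hy⟩⟩
  all_goals
    intros
    cases x <;>
    simp only [OneOrAll, ExactlyOne, factorThree, Fin.val_castSucc, Fin.val_succ, Fin.val_last,
      Set.mem_singleton_iff, spokeEnd, Option.some.injEq, Prod.mk.injEq, reduceCtorEq,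
      ← Fin.val_inj, Fin.val_zero,
      false_and, or_false, true_and, and_true, and_false, false_or, or_true,
      not_true_eq_false, not_false_eq_true, and_self] <;> omega

theorem isOdd_tripleZero (p : Fin t) : IsOdd {pv p.succ 0} (tripleZero p) := by
  refine ⟨⟨?_, ?_, ?_, ?_, ?_⟩, ⟨.two p.castSucc, rfl, ?_⟩⟩
  rotate_right
  · rintro (_ | _ | s | s | _) h <;>
      simp only [spokeEdge, tripleZero, Fin.val_zero] at h
    · omega
    · omega
    · exact congrArg _ (Fin.ext h)
  all_goals
    intros
    simp only [OneOrAll, ExactlyOne, tripleZero, Fin.val_castSucc, Fin.val_succ, Fin.val_last,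
      Set.mem_singleton_iff, Option.some.injEq, Prod.mk.injEq, reduceCtorEq,
      ← Fin.val_inj,
      false_and, or_false, true_and, and_true, and_false, false_or,
      not_false_eq_true, and_self]
    omega

theorem isOdd_tripleTwo (p : Fin t) : IsOdd {pv p.succ 2} (tripleTwo p) := by
  refine ⟨⟨?_, ?_, ?_, ?_, ?_⟩, ⟨.third, ?_, ?_⟩⟩
  rotate_right 2
  · simp only [spokeEdge, tripleTwo, Fin.val_zero]
    omega
  · rintro (_ | _ | s | s | _) h <;>
      simp only [spokeEdge, tripleTwo, Fin.val_zero] at h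
    · omega
    · rfl
  all_goals
    intros
    simp only [OneOrAll, ExactlyOne, tripleTwo, Fin.val_castSucc, Fin.val_succ, Fin.val_last,
      Set.mem_singleton_iff, Option.some.injEq, Prod.mk.injEq, reduceCtorEq,
      ← Fin.val_inj,
      false_and, or_false, true_and, and_true, and_false, false_or,
      not_false_eq_true, and_self]
    omega

theorem isOddOffHub_tripleHub : IsOddOffHub ∅ (tripleHub (t := t)) := by
  refine ⟨?_, ?_, ?_, ?_, ?_⟩
  all_goals
    intros
    simp only [OneOrAll, ExactlyOne, tripleHub, Fin.val_castSucc, Fin.val_succ, Fin.val_last,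
      Set.mem_empty_iff_false, false_and, or_false, true_and, and_true, and_false, false_or,
      not_true_eq_false, not_false_eq_true, and_self]
  all_goals omega

end Factors

/-! ### Classification of the odd factors -/

section Classification

variable {t : ℕ} {T : Set (Option (PathVertex t))} {f g : Edge t → Prop}

theorem OneOrAll.mono {α : Type*} {T T' : Set α} {v : α} {p q r : Prop} (hT : T ⊆ T')
    (h : OneOrAll T v p q r) : OneOrAll T' v p q r :=
  h.imp_right fun h => ⟨hT h.1, h.2⟩

theorem IsOddOffHub.mono {T' : Set (Option (PathVertex t))} (hT : T ⊆ T')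
    (h : IsOddOffHub T f) : IsOddOffHub T' f :=
  ⟨fun s => (h.zero s).mono hT, fun s => (h.one s).mono hT, fun s => (h.two s).mono hT,
    fun s => (h.three s).mono hT, h.tip.mono hT⟩

theorem IsOdd.mono {T' : Set (Option (PathVertex t))} (hT : T ⊆ T') (h : IsOdd T f) :
    IsOdd T' f :=
  ⟨h.toIsOddOffHub.mono hT, h.hub⟩

theorem OneOrAll.parity {α : Type*} {T : Set α} {v : α} {p q r : Prop}
    (h : OneOrAll T v p q r) : r ↔ (p ↔ q) := by
  unfold OneOrAll ExactlyOne at h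
  tauto

theorem eq_zero_of_mem_zero (hT : T ⊆ Set.range spokeEnd) {s : Fin (t + 1)} (h : pv s 0 ∈ T) :
    s = 0 := by
  obtain ⟨_ | _ | _ | _ | _, h⟩ := hT h <;> simp [spokeEnd] at h
  exact h.symm

theorem eq_zero_of_mem_two (hT : T ⊆ Set.range spokeEnd) {s : Fin (t + 1)} (h : pv s 2 ∈ T) :
    s = 0 := by
  obtain ⟨_ | _ | _ | _ | _, h⟩ := hT h <;> simp [spokeEnd] at h
  exact h.symm

/-- The path containing a neighbour of `u'`; for `u` the last path, which is adjacent to it. -/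
def Spoke.path : Spoke t → Fin (t + 1)
  | .first => 0
  | .third => 0
  | .two s => s
  | .four s => s
  | .last => Fin.last t

theorem IsOdd.spokeEdge_iff (hf : IsOdd T f) {x y : Spoke t} (hx : f (spokeEdge x)) :
    f (spokeEdge y) ↔ y = x :=
  ⟨fun hy => hf.hub.unique hy hx, fun h => h ▸ hx⟩

/-- Both edges into a path cannot be used unless the path sends an edge to `u'`. -/
theorem IsOdd.not_and (hT : T ⊆ Set.range spokeEnd) (hf : IsOdd T f) {s : Fin (t + 1)}
    (h2 : ¬ f (.c2 s)) : ¬ (f (.a s.castSucc) ∧ f (.b s.castSucc)) := by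
  rintro ⟨ha, hb⟩
  by_cases hs : s = 0
  · subst hs
    have := hf.hub.unique (y₁ := .first) (y₂ := .third) ha hb
    simp at this
  · have h0 : pv s 0 ∉ T := fun h => hs (eq_zero_of_mem_zero hT h)
    have h2' : pv s 2 ∉ T := fun h => hs (eq_zero_of_mem_two hT h)
    have := hf.zero s
    have := hf.one s
    have := hf.two s
    unfold OneOrAll ExactlyOne at *
    grind

/-- Before the path that is matched to `u'`, the two edges into a path are both used or both
unused. -/
theorem IsOdd.before (hT : T ⊆ Set.range spokeEnd) (hf : IsOdd T f) {p : ℕ}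
    (ha : ¬ f (.a 0)) (hb : ¬ f (.b 0))
    (hc : ∀ s : Fin (t + 1), s.val < p → ¬ f (.c2 s) ∧ ¬ f (.c4 s)) (s : Fin (t + 2)) :
    s.val ≤ p → (f (.a s) ↔ f (.b s)) := by
  induction s using Fin.induction with
  | zero => tauto
  | succ r ih =>
    intro h
    simp only [Fin.val_succ, Fin.val_castSucc] at h ih
    have h1 := hc r h
    have h2 := hf.not_and hT h1.1
    have h3 := ih (by omega)
    have := (hf.zero r).parity
    have := (hf.one r).parity
    have := (hf.two r).parity
    have := (hf.three r).parity
    grind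

/-- Behind the path that is matched to `u'`, exactly one of the two edges into a path is used,
and it is the second one. -/
theorem IsOdd.after (hT : T ⊆ Set.range spokeEnd) (hf : IsOdd T f) {q : Fin (t + 2)}
    (hq : q ≠ 0) (hab : f (.a q) ↔ ¬ f (.b q))
    (hc : ∀ s : Fin (t + 1), q.val ≤ s.val → ¬ f (.c2 s) ∧ ¬ f (.c4 s)) (s : Fin (t + 2)) :
    q < s → ¬ f (.a s) ∧ f (.b s) := by
  induction s using Fin.induction with
  | zero => exact fun h => absurd h (by simp)
  | succ r ih =>
    intro h
    have hqr : q.val ≤ r.val := by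
      rw [Fin.lt_def, Fin.val_succ] at h
      omega
    have hr : r ≠ 0 := by
      rintro rfl
      exact hq (Fin.ext (by simpa using hqr))
    have h0 : pv r 0 ∉ T := fun h => hr (eq_zero_of_mem_zero hT h)
    have h2' : pv r 2 ∉ T := fun h => hr (eq_zero_of_mem_two hT h)
    have hx : f (.a r.castSucc) ↔ ¬ f (.b r.castSucc) := by
      by_cases hqr' : q = r.castSucc
      · rwa [← hqr']
      · have := ih (lt_of_le_of_ne hqr hqr')
        tauto
    have h1 := hc r hqr
    have := hf.zero r
    have := hf.one r
    have := hf.two r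
    have := hf.three r
    unfold OneOrAll ExactlyOne at *
    grind

section Hub

variable {x : Spoke t}

theorem IsOdd.not_c {s : Fin (t + 1)} (hf : IsOdd T f) (hx : f (spokeEdge x)) (hs : s ≠ x.path) :
    ¬ f (.c2 s) ∧ ¬ f (.c4 s) := by
  constructor
  · intro h'
    obtain rfl := hf.hub.unique (y₁ := .two s) h' hx
    exact hs rfl
  · intro h'
    obtain rfl := hf.hub.unique (y₁ := .four s) h' hx
    exact hs rfl

theorem IsOdd.not_initial (hf : IsOdd T f) (hx : f (spokeEdge x)) (hp : x.path ≠ 0) :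
    ¬ f (.a 0) ∧ ¬ f (.b 0) := by
  constructor
  · intro h'
    obtain rfl := hf.hub.unique (y₁ := .first) h' hx
    exact hp rfl
  · intro h'
    obtain rfl := hf.hub.unique (y₁ := .third) h' hx
    exact hp rfl

theorem IsOdd.iff_of_le (hT : T ⊆ Set.range spokeEnd) (hf : IsOdd T f) (hx : f (spokeEdge x))
    (hp : x.path ≠ 0) {s : Fin (t + 2)} (hs : s.val ≤ x.path.val) : f (.a s) ↔ f (.b s) :=
  hf.before hT (hf.not_initial hx hp).1 (hf.not_initial hx hp).2
    (fun r hr => hf.not_c hx fun h => by simp [h] at hr) s hs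

theorem IsOdd.not_of_lt (hT : T ⊆ Set.range spokeEnd) (hf : IsOdd T f) (hx : f (spokeEdge x))
    {s : Fin (t + 2)} (hs : s.val < x.path.val) : ¬ f (.a s) ∧ ¬ f (.b s) := by
  have hp : x.path ≠ 0 := fun h => by simp [h] at hs
  have h1 := hf.iff_of_le hT hx hp hs.le
  obtain ⟨r, rfl⟩ : ∃ r : Fin (t + 1), s = r.castSucc := ⟨⟨s.val, hs.trans x.path.2⟩, rfl⟩
  have h2 := hf.not_and hT (hf.not_c (s := r) hx fun h => by simp [h] at hs).1
  grind

/-- From the path of `x` exactly one edge leads to the next path. -/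
theorem IsOdd.succ_iff_not (hT : T ⊆ Set.range spokeEnd) (hf : IsOdd T f) (hx : f (spokeEdge x))
    (hlast : x ≠ .last) : f (.a x.path.succ) ↔ ¬ f (.b x.path.succ) := by
  have h0 := (hf.zero x.path).parity
  have h1 := (hf.one x.path).parity
  have h2 := (hf.two x.path).parity
  have h3 := (hf.three x.path).parity
  have i1 : f (.c2 x.path) ↔ .two x.path = x := hf.spokeEdge_iff (y := .two x.path) hx
  have i2 : f (.c4 x.path) ↔ .four x.path = x := hf.spokeEdge_iff (y := .four x.path) hx
  have i3 : f (.a 0) ↔ .first = x := hf.spokeEdge_iff (y := .first) hx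
  have i4 : f (.b 0) ↔ .third = x := hf.spokeEdge_iff (y := .third) hx
  have i5 := fun h => hf.iff_of_le hT hx h (s := x.path.castSucc) le_rfl
  cases x with
  | first =>
    simp only [Spoke.path, Fin.castSucc_zero, reduceCtorEq, iff_false, iff_true] at *
    grind
  | third =>
    simp only [Spoke.path, Fin.castSucc_zero, reduceCtorEq, iff_false, iff_true] at *
    grind
  | two p =>
    simp only [Spoke.path, reduceCtorEq, iff_false, iff_true] at *
    have : f (.a p.castSucc) ↔ f (.b p.castSucc) := by
      by_cases hp : p = 0
      · subst hp
        exact iff_of_false i3 i4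
      · exact i5 hp
    grind
  | four p =>
    simp only [Spoke.path, reduceCtorEq, iff_false, iff_true] at *
    have : f (.a p.castSucc) ↔ f (.b p.castSucc) := by
      by_cases hp : p = 0
      · subst hp
        exact iff_of_false i3 i4
      · exact i5 hp
    grind
  | last => exact absurd rfl hlast

theorem IsOdd.of_gt (hT : T ⊆ Set.range spokeEnd) (hf : IsOdd T f) (hx : f (spokeEdge x))
    {s : Fin (t + 2)} (hs : x.path.succ < s) : ¬ f (.a s) ∧ f (.b s) := by
  refine hf.after hT (Fin.succ_ne_zero _) (hf.succ_iff_not hT hx ?_)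
    (fun r hr => hf.not_c hx ?_) s hs
  · rintro rfl
    exact absurd hs (by simpa [Spoke.path] using Fin.le_last s)
  · rintro rfl
    simp at hr

/-- An odd factor is determined by its edge at `u'` together with the use of the edges `a` and
`e1` at the first vertex of the path concerned. -/
theorem IsOdd.ext (hT : T ⊆ Set.range spokeEnd) (hf : IsOdd T f) (hg : IsOdd T g)
    (hfx : f (spokeEdge x)) (hgx : g (spokeEdge x))
    (ha : f (.a x.path.castSucc) ↔ g (.a x.path.castSucc))
    (he : f (.e1 x.path) ↔ g (.e1 x.path)) : f = g := by
  have hspoke : ∀ y, f (spokeEdge y) ↔ g (spokeEdge y) := fun y => by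
    rw [hf.spokeEdge_iff hfx, hg.spokeEdge_iff hgx]
  have hc2 : ∀ s, f (.c2 s) ↔ g (.c2 s) := fun s => hspoke (.two s)
  have hc4 : ∀ s, f (.c4 s) ↔ g (.c4 s) := fun s => hspoke (.four s)
  have hb : f (.b x.path.castSucc) ↔ g (.b x.path.castSucc) := by
    by_cases hp : x.path = 0
    · rw [hp]
      exact hspoke .third
    · rw [← hf.iff_of_le hT hfx hp le_rfl, ← hg.iff_of_le hT hgx hp le_rfl, ha]
  have ha' : f (.a x.path.succ) ↔ g (.a x.path.succ) := by
    have h1 := (hf.zero x.path).parity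
    have h2 := (hg.zero x.path).parity
    grind
  have hb' : f (.b x.path.succ) ↔ g (.b x.path.succ) := by
    have f1 := (hf.one x.path).parity
    have f2 := (hf.two x.path).parity
    have f3 := (hf.three x.path).parity
    have g1 := (hg.one x.path).parity
    have g2 := (hg.two x.path).parity
    have g3 := (hg.three x.path).parity
    have h1 := hc2 x.path
    have h2 := hc4 x.path
    grind
  have hab : ∀ s : Fin (t + 2), (f (.a s) ↔ g (.a s)) ∧ (f (.b s) ↔ g (.b s)) := by
    intro s
    rcases lt_or_ge s.val x.path.val with hs | hs
    · have h1 := hf.not_of_lt hT hfx hs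
      have h2 := hg.not_of_lt hT hgx hs
      exact ⟨iff_of_false h1.1 h2.1, iff_of_false h1.2 h2.2⟩
    · rcases lt_or_ge x.path.succ s with hs' | hs'
      · have h1 := hf.of_gt hT hfx hs'
        have h2 := hg.of_gt hT hgx hs'
        exact ⟨iff_of_false h1.1 h2.1, iff_of_true h1.2 h2.2⟩
      · rcases eq_or_ne s x.path.succ with rfl | hne
        · exact ⟨ha', hb'⟩
        · have : s = x.path.castSucc := by
            have h1 := Fin.val_ne_of_ne hne
            rw [Fin.le_def, Fin.val_succ] at hs'
            rw [Fin.val_succ] at h1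
            exact Fin.ext (by rw [Fin.val_castSucc]; omega)
          subst this
          exact ⟨ha, hb⟩
  have he1 : ∀ s, f (.e1 s) ↔ g (.e1 s) := fun s => by
    rw [(hf.zero s).parity, (hg.zero s).parity, (hab _).1, (hab _).1]
  funext l
  apply propext
  cases l with
  | a s => exact (hab s).1
  | b s => exact (hab s).2
  | e1 s => exact he1 s
  | e2 s => rw [(hf.one s).parity, (hg.one s).parity, he1 s, hc2 s]
  | e3 s =>
    rw [(hf.two s).parity, (hg.two s).parity, (hab _).2, (hf.one s).parity, (hg.one s).parity,
      he1 s, hc2 s]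
  | c2 s => exact hc2 s
  | c4 s => exact hc4 s
  | cu => exact hspoke .last

end Hub

/-- The odd factors for `T`: each spoke `x` gives one with degree one at `x` and, if `x` is in `T`,
one with degree three at `x`; the others are the `factorBeta p`. -/
abbrev FactorIndex (T : Set (Option (PathVertex t))) : Type :=
  Spoke t ⊕ {x : Spoke t // spokeEnd x ∈ T} ⊕ Fin t

/-- The odd factor with a given index. -/
def factor (T : Set (Option (PathVertex t))) : FactorIndex T → Edge t → Prop
  | .inl x => factorOne x
  | .inr (.inl x) => factorThree x.1
  | .inr (.inr p) => factorBeta p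

theorem isOdd_factor (κ : FactorIndex T) : IsOdd T (factor T κ) := by
  rcases κ with x | x | p
  · exact (isOdd_factorOne x).mono (Set.empty_subset T)
  · exact (isOdd_factorThree x.1).mono (by simpa using x.2)
  · exact (isOdd_factorBeta p).mono (Set.empty_subset T)

theorem IsOdd.exists_eq_factor (hT : T ⊆ Set.range spokeEnd) (hf : IsOdd T f) :
    ∃ κ, f = factor T κ := by
  obtain ⟨x, hx, -⟩ := hf.hub
  -- It suffices to find an odd factor with the same edges `a` and `e1` on the path of `x`.
  suffices h : ∃ κ, factor T κ (spokeEdge x) ∧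
      (f (.a x.path.castSucc) ↔ factor T κ (.a x.path.castSucc)) ∧
      (f (.e1 x.path) ↔ factor T κ (.e1 x.path)) by
    obtain ⟨κ, h1, h2, h3⟩ := h
    exact ⟨κ, hf.ext hT (isOdd_factor κ) hx h1 h2 h3⟩
  have h0 := hf.zero x.path
  have h1 := hf.one x.path
  have h2 := hf.two x.path
  have h3 := hf.three x.path
  have i1 : f (.c2 x.path) ↔ .two x.path = x := hf.spokeEdge_iff (y := .two x.path) hx
  have i2 : f (.c4 x.path) ↔ .four x.path = x := hf.spokeEdge_iff (y := .four x.path) hx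
  have i3 : f (.a 0) ↔ .first = x := hf.spokeEdge_iff (y := .first) hx
  have i4 : f (.b 0) ↔ .third = x := hf.spokeEdge_iff (y := .third) hx
  have i5 := fun h => hf.iff_of_le hT hx h (s := x.path.castSucc) le_rfl
  cases x with
  | first =>
    simp only [Spoke.path, Fin.castSucc_zero, reduceCtorEq, iff_false, iff_true] at *
    by_cases he : f (.e1 0)
    · have hmem : pv 0 0 ∈ T := by
        unfold OneOrAll ExactlyOne at *
        grind
      exact ⟨.inr (.inl ⟨.first, hmem⟩), (factorThree_spokeEdge (x := (.first : Spoke t))).2 rfl,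
        by simp [factor, factorThree, i3], by simp [factor, factorThree, he]⟩
    · exact ⟨.inl .first, (factorOne_spokeEdge (x := (.first : Spoke t))).2 rfl,
        by simp [factor, factorOne, i3], by simp [factor, factorOne, he]⟩
  | third =>
    simp only [Spoke.path, Fin.castSucc_zero, reduceCtorEq, iff_false, iff_true] at *
    by_cases he : f (.e1 0)
    · exact ⟨.inl .third, (factorOne_spokeEdge (x := (.third : Spoke t))).2 rfl,
        by simp [factor, factorOne, i3], by simp [factor, factorOne, he]⟩
    · have hmem : pv 0 2 ∈ T := by
        unfold OneOrAll ExactlyOne at *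
        grind
      exact ⟨.inr (.inl ⟨.third, hmem⟩), (factorThree_spokeEdge (x := (.third : Spoke t))).2 rfl,
        by simp [factor, factorThree, i3], by simp [factor, factorThree, he]⟩
  | two p =>
    simp only [Spoke.path, reduceCtorEq, iff_false, iff_true] at *
    by_cases ha : f (.a p.castSucc)
    · cases p using Fin.cases with
      | zero => exact absurd ha i3
      | succ p =>
        have h0T : pv p.succ 0 ∉ T := fun h => Fin.succ_ne_zero p (eq_zero_of_mem_zero hT h)
        have he : ¬ f (.e1 p.succ) := by
          unfold OneOrAll ExactlyOne at *
          grind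
        exact ⟨.inr (.inr p), factorBeta_spokeEdge.2 rfl,
          iff_of_true ha (by simp [factor, factorBeta, -Fin.castSucc_succ]), by simp [factor, factorBeta, he]⟩
    · by_cases he : f (.e1 p)
      · have hmem : pv p 1 ∈ T := by
          unfold OneOrAll ExactlyOne at *
          grind
        exact ⟨.inr (.inl ⟨.two p, hmem⟩), (factorThree_spokeEdge (x := .two p)).2 rfl,
          by simp [factor, factorThree, ha], by simp [factor, factorThree, he]⟩
      · exact ⟨.inl (.two p), (factorOne_spokeEdge (x := .two p)).2 rfl,
          by simp [factor, factorOne, ha], by simp [factor, factorOne, he]⟩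
  | four p =>
    simp only [Spoke.path, reduceCtorEq, iff_false, iff_true] at *
    have hab : f (.a p.castSucc) ↔ f (.b p.castSucc) := by
      by_cases hp : p = 0
      · subst hp
        exact iff_of_false i3 i4
      · exact i5 hp
    have ha : ¬ f (.a p.castSucc) := fun h => hf.not_and hT i1 ⟨h, hab.1 h⟩
    by_cases he : f (.e1 p)
    · have hmem : pv p 3 ∈ T := by
        unfold OneOrAll ExactlyOne at *
        grind
      exact ⟨.inr (.inl ⟨.four p, hmem⟩), (factorThree_spokeEdge (x := .four p)).2 rfl,
        by simp [factor, factorThree, ha], by simp [factor, factorThree, he]⟩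
    · exact ⟨.inl (.four p), (factorOne_spokeEdge (x := .four p)).2 rfl,
        by simp [factor, factorOne, ha], by simp [factor, factorOne, he]⟩
  | last =>
    simp only [Spoke.path, reduceCtorEq, iff_false] at *
    have hab : f (.a (Fin.last t).castSucc) ↔ f (.b (Fin.last t).castSucc) := by
      by_cases hp : Fin.last t = 0
      · rw [hp]
        exact iff_of_false i3 i4
      · exact i5 hp
    have ha : ¬ f (.a (Fin.last t).castSucc) := fun h => hf.not_and hT i1 ⟨h, hab.1 h⟩
    by_cases he : f (.e1 (Fin.last t))
    · exact ⟨.inl .last, (factorOne_spokeEdge (x := (.last : Spoke t))).2 rfl,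
        by simp [factor, factorOne, ha], by simp [factor, factorOne, he]⟩
    · have h4 := hf.tip
      have hx' : f .cu := hx
      rw [Fin.succ_last] at h0 h3
      have hmem : tip ∈ T := by
        unfold OneOrAll ExactlyOne at *
        grind
      exact ⟨.inr (.inl ⟨.last, hmem⟩), (factorThree_spokeEdge (x := (.last : Spoke t))).2 rfl,
        by simp [factor, factorThree, ha], by simp [factor, factorThree, he]⟩

end Classification

/-! ### Linear independence of the odd factors -/

section Final

variable {t : ℕ} {T : Set (Option (PathVertex t))}

theorem notMem_none (hT : T ⊆ Set.range spokeEnd) : none ∉ T := by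
  intro h
  obtain ⟨_ | _ | _ | _ | _, h⟩ := hT h <;> simp [spokeEnd] at h

theorem ncard_neighborSet_of_mem (hT : T ⊆ Set.range spokeEnd) :
    ∀ v ∈ T, ((primeGraph t).neighborSet v).ncard = 3 := by
  rintro (_ | v) hv
  · exact absurd hv (notMem_none hT)
  · exact ncard_neighborSet_some v

open Classical in
theorem adjFun_graphOf {f : Edge t → Prop} {l : Edge t} {v w : Option (PathVertex t)}
    (h : ends l = s(v, w)) : adjFun (graphOf f) v w = if f l then 1 else 0 := by
  rw [adjFun]
  simp only [graphOf_adj h]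

theorem sum_adjFun {α : Type*} [Fintype α] (H : SimpleGraph α) (v : α) :
    ∑ w, adjFun H v w = (H.neighborSet v).ncard := by
  classical
  simp only [adjFun, Finset.sum_boole]
  rw [Set.ncard_eq_toFinset_card']
  congr 2
  ext w
  simp

theorem ncard_factorOne (x y : Spoke t) :
    ((graphOf (factorOne x)).neighborSet (spokeEnd y)).ncard = 1 := by
  rw [← existsUnique_adj_iff_ncard]
  exact (((isOddFactor_graphOf (Set.notMem_empty _)).2 (isOdd_factorOne x)).2 _).resolve_right
    fun h => h.1

theorem ncard_factorBeta (p : Fin t) (y : Spoke t) :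
    ((graphOf (factorBeta p)).neighborSet (spokeEnd y)).ncard = 1 := by
  rw [← existsUnique_adj_iff_ncard]
  exact (((isOddFactor_graphOf (Set.notMem_empty _)).2 (isOdd_factorBeta p)).2 _).resolve_right
    fun h => h.1

theorem spokeEnd_ne_none (x : Spoke t) : none ≠ spokeEnd x := by
  cases x <;> simp [spokeEnd]

theorem ncard_factorThree_of_ne {x y : Spoke t} (h : y ≠ x) :
    ((graphOf (factorThree x)).neighborSet (spokeEnd y)).ncard = 1 := by
  rw [← existsUnique_adj_iff_ncard]
  refine (((isOddFactor_graphOf ?_).2 (isOdd_factorThree x)).2 _).resolve_right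
    fun h' => h (spokeEnd_injective h'.1)
  exact spokeEnd_ne_none x

/-- The degree of `x` in `factorThree x` is three, as it is not one. -/
theorem factorThree_adj_spokeEnd (x : Spoke t) {w : Option (PathVertex t)}
    (hw : (primeGraph t).Adj (spokeEnd x) w) : (graphOf (factorThree x)).Adj (spokeEnd x) w := by
  have h := ((isOddFactor_graphOf (spokeEnd_ne_none x)).2 (isOdd_factorThree x)).2 (spokeEnd x)
  refine (h.resolve_left ?_).2 w hw
  rintro ⟨u, -, hu⟩
  have hn : (graphOf (factorThree x)).Adj (spokeEnd x) none :=
    ((graphOf_adj (ends_spokeEdge x)).2 (factorThree_spokeEdge.2 rfl)).symm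
  suffices h : ∃ v, (graphOf (factorThree x)).Adj (spokeEnd x) (some v) by
    obtain ⟨v, hv⟩ := h
    have := (hu _ hn).trans (hu _ hv).symm
    simp at this
  cases x with
  | first => exact ⟨some (0, 1), .e1 0, by simp [factorThree], rfl⟩
  | third => exact ⟨some (0, 3), .e3 0, by simp [factorThree], rfl⟩
  | two p => exact ⟨some (p, 0), .e1 p, trivial, Sym2.eq_swap⟩
  | four p => exact ⟨some (p, 2), .e3 p, by simp [factorThree], Sym2.eq_swap⟩
  | last =>
    refine ⟨some (Fin.last t, 0), .a (Fin.last _), by simp [factorThree], ?_⟩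
    exact ends_eq_tip.2 (Or.inr (Or.inl ⟨rfl, (lo_last 0).symm⟩))

theorem neighborSet_factorThree (x : Spoke t) :
    (graphOf (factorThree x)).neighborSet (spokeEnd x) =
      (primeGraph t).neighborSet (spokeEnd x) :=
  Set.Subset.antisymm (fun _ h => graphOf_le _ h) fun _ h => factorThree_adj_spokeEnd x h

theorem ncard_neighborSet_spokeEnd (x : Spoke t) :
    ((primeGraph t).neighborSet (spokeEnd x)).ncard = 3 :=
  ncard_neighborSet_of_mem Set.Subset.rfl _ ⟨x, rfl⟩

/-- The odd factors are linearly independent. The difference of the degrees at a spoke `x` and at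
`u'` vanishes on all of them except the one with degree three at `x`, so the latter do not occur in
a linear relation. Then the edges at `u'` eliminate all but the `two p`, and for
these the edges `a` between consecutive paths allow an induction on `p`. -/
theorem linearIndependent_factor (T : Set (Option (PathVertex t))) :
    LinearIndependent ℚ fun κ : FactorIndex T => adjFun (graphOf (factor T κ)) := by
  classical
  have := Fintype.ofFinite (Spoke t)
  rw [Fintype.linearIndependent_iff]
  intro g hg
  have hev : ∀ v w, ∑ κ, g κ * adjFun (graphOf (factor T κ)) v w = 0 := by
    intro v w
    have := congrFun (congrFun hg v) w
    simpa using this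
  have hdeg : ∀ v, ∑ κ, g κ * ((graphOf (factor T κ)).neighborSet v).ncard = 0 := by
    intro v
    simp only [← sum_adjFun, Finset.mul_sum]
    rw [Finset.sum_comm]
    exact Finset.sum_eq_zero fun w _ => hev v w
  have hhub : ∀ κ, ((graphOf (factor T κ)).neighborSet none).ncard = 1 := fun κ =>
    existsUnique_adj_iff_ncard.1 (existsUnique_graphOf_adj_none.2 (isOdd_factor κ).hub)
  have hthree : ∀ x, g (.inr (.inl x)) = 0 := by
    intro x
    have h1 : ∑ κ, (g κ * ((graphOf (factor T κ)).neighborSet (spokeEnd x.1)).ncard -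
        g κ * ((graphOf (factor T κ)).neighborSet none).ncard) = 0 := by
      rw [Finset.sum_sub_distrib, hdeg, hdeg, sub_zero]
    simp only [hhub] at h1
    rw [Finset.sum_eq_single (.inr (.inl x))] at h1
    · rw [factor, neighborSet_factorThree, ncard_neighborSet_spokeEnd] at h1
      push_cast at h1
      linarith
    · rintro (y | y | p) - hne
      · rw [factor, ncard_factorOne, sub_self]
      · rw [factor, ncard_factorThree_of_ne, sub_self]
        rintro h
        exact hne (by rw [Subtype.ext h])
      · rw [factor, ncard_factorBeta, sub_self]
    · simp
  have hl : ∀ l, ∑ x, g (.inl x) * (if factorOne x l then 1 else 0) +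
      ∑ p, g (.inr (.inr p)) * (if factorBeta p l then 1 else 0) = 0 := by
    intro l
    have := hev (src l) (tgt l)
    rw [Fintype.sum_sum_type, Fintype.sum_sum_type] at this
    simpa only [hthree, zero_mul, Finset.sum_const_zero, zero_add, factor,
      adjFun_graphOf (show ends l = s(src l, tgt l) from rfl)] using this
  have hspoke : ∀ y, g (.inl y) +
      ∑ p, g (.inr (.inr p)) * (if y = .two p.succ then 1 else 0) = 0 := by
    intro y
    have := hl (spokeEdge y)
    simpa only [factorOne_spokeEdge, factorBeta_spokeEdge, mul_ite, mul_one, mul_zero,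
      Finset.sum_ite_eq, Finset.mem_univ, if_true] using this
  have hone : ∀ y, (∀ p : Fin t, y ≠ .two p.succ) → g (.inl y) = 0 := by
    intro y hy
    have := hspoke y
    simpa [hy] using this
  have htwo : ∀ p : Fin t, g (.inl (.two p.succ)) + g (.inr (.inr p)) = 0 := by
    intro p
    have := hspoke (.two p.succ)
    simpa using this
  have hbeta : ∀ p : Fin t, g (.inl (.two p.castSucc)) + g (.inr (.inr p)) = 0 := by
    intro p
    have := hl (.a p.castSucc.succ)
    rw [Finset.sum_eq_single (.two p.castSucc), Finset.sum_eq_single p] at this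
    · simpa [factorOne, factorBeta] using this
    · intro q _ hq
      have : ¬ p.val = q.val := fun h => hq (Fin.ext h.symm)
      simp [factorBeta, this]
    · simp
    · rintro (_ | _ | q | q | _) - hq
      · simp [factorOne]
      · simp [factorOne]
      · have : ¬ p.val = q.val := fun h => hq (congrArg _ (Fin.ext h.symm))
        simp [factorOne, this]
      · rw [hone _ (by simp), zero_mul]
      · simp [factorOne]
    · simp
  have hzero : ∀ s, g (.inl (.two s)) = 0 := by
    intro s
    induction s using Fin.induction with
    | zero => exact hone _ fun p h => Fin.succ_ne_zero p (by simpa using h.symm)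
    | succ p ih => linarith [htwo p, hbeta p]
  rintro (y | x | p)
  · by_cases hy : ∃ s, y = .two s
    · obtain ⟨s, rfl⟩ := hy
      exact hzero s
    · exact hone y fun p h => hy ⟨_, h⟩
  · exact hthree x
  · linarith [htwo p, hzero p.succ]

/-- The indices of the odd factors enumerate the perfect matchings. -/
noncomputable def factorEquiv (hT : T ⊆ Set.range spokeEnd) :
    FactorIndex T ≃ {H : SimpleGraph (Option (PathVertex t)) //
      IsOddFactor (primeGraph t) T H} :=
  Equiv.ofBijective
    (fun κ =>
      ⟨graphOf (factor T κ), (isOddFactor_graphOf (notMem_none hT)).2 (isOdd_factor κ)⟩) <| by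
    constructor
    · intro κ κ' h
      exact (linearIndependent_factor T).injective (congrArg adjFun (Subtype.ext_iff.1 h))
    · rintro ⟨H, hH⟩
      obtain ⟨f, rfl⟩ := exists_eq_graphOf hH.1
      obtain ⟨κ, rfl⟩ := ((isOddFactor_graphOf (notMem_none hT)).1 hH).exists_eq_factor hT
      exact ⟨κ, rfl⟩

theorem linearIndependent_triangleInsertion (hT : T ⊆ Set.range spokeEnd) :
    LinearIndependent ℚ
      fun (M : {M : (triangleInsertion (primeGraph t) T).Subgraph // M.IsPerfectMatching})
        (e : (triangleInsertion (primeGraph t) T).edgeSet) =>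
          (incidenceVector (triangleInsertion (primeGraph t) T) M.1 e : ℚ) :=
  linearIndependent_incidenceVector (ncard_neighborSet_of_mem hT)
    ((linearIndependent_equiv (factorEquiv hT)).1 (linearIndependent_factor T))

theorem numPM_triangleInsertion (hT : T ⊆ Set.range spokeEnd) :
    numPM (triangleInsertion (primeGraph t) T) = 3 * t + 5 + T.ncard := by
  rw [numPM, Nat.card_congr ((oddFactorEquiv (ncard_neighborSet_of_mem hT)).trans
    (factorEquiv hT).symm), Nat.card_sum, Nat.card_sum, card_spoke, Nat.card_fin]
  have : Nat.card {x : Spoke t // spokeEnd x ∈ T} = T.ncard := by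
    rw [← Set.ncard_preimage_of_injective_subset_range spokeEnd_injective hT]
    rfl
  omega

theorem adj_spokeEnd_none (x : Spoke t) : (primeGraph t).Adj (spokeEnd x) none :=
  primeGraph_adj_iff.2 ⟨spokeEdge x, (ends_spokeEdge x).trans Sym2.eq_swap⟩

theorem isMatchingCovered_triangleInsertion_primeGraph (hT : T ⊆ Set.range spokeEnd) (hne : T.Nonempty) :
    IsMatchingCovered (triangleInsertion (primeGraph t) T) := by
  refine isMatchingCovered_triangleInsertion (ncard_neighborSet_of_mem hT) ?_
    (connected_primeGraph t) ?_
  · obtain ⟨v, hv⟩ := hne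
    obtain ⟨x, rfl⟩ := hT hv
    exact ⟨⟨.inr ⟨⟨(spokeEnd x, none), adj_spokeEnd_none x⟩, hv⟩, .inl ⟨none, notMem_none hT⟩,
      by simp⟩⟩
  · intro v w h
    obtain ⟨l, hl⟩ := primeGraph_adj_iff.1 h
    suffices h : ∃ x, factorOne x l by
      obtain ⟨x, hx⟩ := h
      refine ⟨graphOf (factorOne x), graphOf_le _, fun u => ?_, (graphOf_adj hl).2 hx⟩
      exact (((isOddFactor_graphOf (Set.notMem_empty _)).2 (isOdd_factorOne x)).2 u).resolve_right
        fun h => h.1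
    cases l with
    | a s =>
      cases s using Fin.cases with
      | zero => exact ⟨.first, rfl⟩
      | succ s => exact ⟨.two s, rfl⟩
    | b s => exact ⟨.third, trivial⟩
    | e1 s => exact ⟨.last, trivial⟩
    | e2 s => exact ⟨.four s, Or.inl rfl⟩
    | e3 s => exact ⟨.last, trivial⟩
    | c2 s => exact ⟨.two s, rfl⟩
    | c4 s => exact ⟨.four s, rfl⟩
    | cu => exact ⟨.last, trivial⟩

/-! ### The bricks -/

theorem hasTripleFactor_none (hT : T ⊆ Set.range spokeEnd) :
    HasTripleFactor (triangleInsertion (primeGraph t) T) (.inl ⟨none, notMem_none hT⟩) := by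
  refine hasTripleFactor_inl (ncard_neighborSet_of_mem hT) (graphOf_le tripleHub) ?_ ?_
  · rw [Set.ncard_eq_three]
    refine ⟨pv 0 0, pv 0 2, pv 0 1, by simp, by simp, by simp, ?_⟩
    ext w
    simp only [SimpleGraph.mem_neighborSet, Set.mem_insert_iff, Set.mem_singleton_iff]
    constructor
    · intro h
      obtain ⟨x, rfl⟩ := (nbr_none w).1 (graphOf_le _ h)
      have := (graphOf_adj (ends_spokeEdge x)).1 h
      cases x with
      | first => exact Or.inl rfl
      | third => exact Or.inr (Or.inl rfl)
      | two s =>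
        obtain rfl : s = 0 := Fin.ext this
        exact Or.inr (Or.inr rfl)
      | four s => exact this.elim
      | last => exact this.elim
    · rintro (rfl | rfl | rfl)
      · exact (graphOf_adj (ends_spokeEdge .first)).2 rfl
      · exact (graphOf_adj (ends_spokeEdge .third)).2 trivial
      · exact (graphOf_adj (ends_spokeEdge (.two 0))).2 rfl
  · rintro (_ | v) hv
    · exact absurd rfl hv
    · exact Or.inl ((isOddOffHub_iff.1 isOddOffHub_tripleHub v).resolve_right fun h => h.1)

/-- For every vertex `v ≠ u'` of `G'_t` some spanning subgraph has degree three at `v` and one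
elsewhere. -/
theorem exists_isOdd_singleton (v : PathVertex t) : ∃ f, IsOdd {some v} f ∧
    ∀ w, (primeGraph t).Adj (some v) w → (graphOf f).Adj (some v) w := by
  have hspoke : ∀ x : Spoke t, spokeEnd x = some v → ∃ f, IsOdd {some v} f ∧
      ∀ w, (primeGraph t).Adj (some v) w → (graphOf f).Adj (some v) w := by
    rintro x hx
    rw [← hx]
    exact ⟨factorThree x, isOdd_factorThree x, fun w => factorThree_adj_spokeEnd x⟩
  rcases v with _ | ⟨s, j⟩
  · exact hspoke .last rfl
  · fin_cases j
    · cases s using Fin.cases with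
      | zero => exact hspoke .first rfl
      | succ p =>
        have h := isOdd_tripleZero p
        refine ⟨tripleZero p, h, ((oneOrAll_zero p.succ).2 (h.zero p.succ)).resolve_left ?_ |>.2⟩
        rintro ⟨u, -, hu⟩
        have h1 := hu (lo 0 p.succ.castSucc) ((graphOf_adj (l := .a p.succ.castSucc)
          (by simp [ends_eq_pv_zero])).2 (by simp [tripleZero, -Fin.castSucc_succ]))
        have h2 := hu (pv p.succ 1) ((graphOf_adj (l := .e1 p.succ) rfl).2 (by simp [tripleZero]))
        exact lo_ne_pv _ _ _ (h1.trans h2.symm)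
    · exact hspoke (.two s) rfl
    · cases s using Fin.cases with
      | zero => exact hspoke .third rfl
      | succ p =>
        have h := isOdd_tripleTwo p
        refine ⟨tripleTwo p, h, ((oneOrAll_two p.succ).2 (h.two p.succ)).resolve_left ?_ |>.2⟩
        rintro ⟨u, -, hu⟩
        have h1 := hu (pv p.succ 1) ((graphOf_adj (l := .e2 p.succ) Sym2.eq_swap).2
          (by simp [tripleTwo]))
        have h2 := hu (pv p.succ 3) ((graphOf_adj (l := .e3 p.succ) rfl).2 (by simp [tripleTwo]))
        simpa using h1.trans h2.symm
    · exact hspoke (.four s) rfl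

theorem hasTripleFactor_of_notMem (hT : T ⊆ Set.range spokeEnd)
    (w : {v : Option (PathVertex t) // v ∉ T}) :
    HasTripleFactor (triangleInsertion (primeGraph t) T) (.inl w) := by
  obtain ⟨_ | v, hw⟩ := w
  · exact hasTripleFactor_none hT
  · obtain ⟨f, hf, hv⟩ := exists_isOdd_singleton v
    refine hasTripleFactor_inl (ncard_neighborSet_of_mem hT) (graphOf_le f) ?_ ?_
    · rw [← ncard_neighborSet_some v]
      congr 1
      exact Set.Subset.antisymm (fun _ h => graphOf_le _ h) hv
    · intro u hu
      exact Or.inl ((((isOddFactor_graphOf (by simp)).2 hf).2 u).resolve_right fun h => hu h.1)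

theorem card_primeGraph (t : ℕ) : Nat.card (Option (PathVertex t)) = 4 * t + 6 := by
  simp
  omega

/-- Triangle-insertions at any nonempty set of neighbours of `u'` turn `G'_t` into an extremal
brick. -/
theorem isExtremalBrick_triangleInsertion (hT : T ⊆ Set.range spokeEnd) (hne : T.Nonempty) :
    IsExtremalBrick (triangleInsertion (primeGraph t) T) := by
  classical
  have := Fintype.ofFinite (InsertionVertex (primeGraph t) T)
  have hN := ncard_neighborSet_of_mem hT
  obtain ⟨v, hv⟩ := hne
  obtain ⟨x, rfl⟩ := hT hv
  let d : {d : (primeGraph t).Dart // d.fst ∈ T} := ⟨⟨(spokeEnd x, none), adj_spokeEnd_none x⟩, hv⟩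
  obtain ⟨y, z, hy, hz, hyz⟩ := exists_triangle_inr hN d
  refine isExtremalBrick_of_linearIndependent
    (isMatchingCovered_triangleInsertion_primeGraph hT ⟨_, hv⟩) hy hz hyz ?_
    (linearIndependent_triangleInsertion hT) ?_
  · rintro (w | e)
    · exact Or.inr (hasTripleFactor_of_notMem hT w)
    · exact Or.inl (exists_triangle_inr hN e)
  · rw [numPM_triangleInsertion hT, ← Nat.card_eq_fintype_card, card_insertionVertex hN,
      ncard_edgeSet_triangleInsertion hN, card_primeGraph, ncard_edgeSet_primeGraph]
    omega

theorem ncard_S (t : ℕ) : (S t).ncard = 2 * t + 5 := by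
  rw [← Set.ncard_image_of_injective _ (Option.some_injective _), ← range_spokeEnd,
    ← Set.image_univ, Set.ncard_image_of_injective _ spokeEnd_injective, Set.ncard_univ, card_spoke]

theorem insertionSet_subset (t k : ℕ) : insertionSet t k ⊆ Set.range spokeEnd := by
  rw [range_spokeEnd]
  refine Set.image_mono ?_
  unfold Ssub
  split
  · exact Set.sdiff_subset
  · exact Set.sdiff_subset
  · exact Set.sdiff_subset
  · exact Set.Subset.rfl

theorem ncard_insertionSet (t : ℕ) {k : ℕ} (h1 : 1 ≤ k) (h4 : k ≤ 4) :
    (insertionSet t k).ncard = 2 * t + 1 + k := by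
  rw [insertionSet, Set.ncard_image_of_injective _ (Option.some_injective _)]
  have h2 : some (Fin.last t, 1) ∈ S t := Or.inr ⟨_, Or.inl rfl⟩
  have h3 : some (Fin.last t, 3) ∈ S t := Or.inr ⟨_, Or.inr rfl⟩
  have h0 : none ∈ S t := Or.inl (by simp)
  have hS := ncard_S t
  interval_cases k
  · rw [Ssub, Set.ncard_sdiff (by simp [Set.insert_subset_iff, h0, h2, h3]), hS,
      Set.ncard_eq_three.2 ⟨_, _, _, by simp, by simp, by simp, rfl⟩]
    omega
  · rw [Ssub, Set.ncard_sdiff (by simp [Set.insert_subset_iff, h0, h3]), hS,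
      Set.ncard_pair (by simp)]
    omega
  · rw [Ssub, Set.ncard_sdiff (by simp [h0]), hS, Set.ncard_singleton]
    omega
  · exact hS

/-- The numbers of vertices, edges and perfect matchings of `G''_n`, in a form free of subtraction
and division. -/
theorem exists_doublePrimeGraph {n : ℕ} (hn : Even n) (h18 : 18 ≤ n) :
    ∃ t i : ℕ, 0 < t ∧ 0 < i ∧ i ≤ 8 ∧ n = i + 8 * (t + 1) ∧
      (∀ v ∈ insertionSet t (i / 2), ((primeGraph t).neighborSet v).ncard = 3) ∧
      Nat.card (DoublePrimeVertex t (i / 2)) = n ∧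
      IsExtremalBrick (doublePrimeGraph t (i / 2)) ∧
      numPM (doublePrimeGraph t (i / 2)) + n = (doublePrimeGraph t (i / 2)).edgeSet.ncard + 1 ∧
      8 * numPM (doublePrimeGraph t (i / 2)) + i = 5 * n + 8 := by
  obtain ⟨m, hm⟩ := hn
  obtain ⟨t, k, ht, hk1, hk4, hnt⟩ : ∃ t k : ℕ, 0 < t ∧ 1 ≤ k ∧ k ≤ 4 ∧ n = 2 * k + 8 * (t + 1) :=
    ⟨(m - 1) / 4 - 1, (m - 1) % 4 + 1, by omega, by omega, by omega, by omega⟩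
  have hk : 2 * k / 2 = k := by omega
  have hT := insertionSet_subset t k
  have hN := ncard_neighborSet_of_mem hT
  have hcard := ncard_insertionSet t hk1 hk4
  have hV := card_insertionVertex hN
  have hE := ncard_edgeSet_triangleInsertion hN
  have hPM := numPM_triangleInsertion hT
  rw [card_primeGraph] at hV
  rw [ncard_edgeSet_primeGraph] at hE
  have hne : (insertionSet t k).Nonempty := by
    rw [Set.nonempty_iff_ne_empty]
    intro h
    rw [h, Set.ncard_empty] at hcard
    omega
  refine ⟨t, 2 * k, ht, by omega, by omega, hnt, ?_⟩
  rw [hk, doublePrimeGraph]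
  exact ⟨hN, hV.trans (by omega), isExtremalBrick_triangleInsertion hT hne, by omega, by omega⟩

theorem not_lucchesiMurtyConjecture : ¬ LucchesiMurtyConjecture := by
  rintro ⟨N, -, hN⟩
  obtain ⟨t, i, -, hi, -, -, -, hV, hbrick, -, hPM⟩ :=
    exists_doublePrimeGraph (n := 2 * (N + 9)) (by simp) (by omega)
  have hfin : Finite (DoublePrimeVertex t (i / 2)) := Nat.finite_of_card_ne_zero (by omega)
  have := hN (2 * (N + 9)) (by omega) _ (doublePrimeGraph t (i / 2)) hV hbrick.1
  omega

end Final

end ExtremalBrick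

theorem theorem3p1 :
    (∀ n : ℕ, Even n → 18 ≤ n →
      ∃ t i : ℕ, 0 < t ∧ 0 < i ∧ i ≤ 8 ∧ n = i + 8 * (t + 1) ∧
        (∀ v ∈ ExtremalBrick.insertionSet t (i / 2),
          ((ExtremalBrick.primeGraph t).neighborSet v).ncard = 3) ∧
        Nat.card (ExtremalBrick.DoublePrimeVertex t (i / 2)) = n ∧
        ExtremalBrick.IsExtremalBrick (ExtremalBrick.doublePrimeGraph t (i / 2)) ∧
        (ExtremalBrick.numPM (ExtremalBrick.doublePrimeGraph t (i / 2)) : ℤ) =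
          ((ExtremalBrick.doublePrimeGraph t (i / 2)).edgeSet.ncard : ℤ) - (n : ℤ) + 1 ∧
        (ExtremalBrick.numPM (ExtremalBrick.doublePrimeGraph t (i / 2)) : ℤ) =
          ⌈(5 * (n : ℚ)) / 8⌉ ∧
        (ExtremalBrick.numPM (ExtremalBrick.doublePrimeGraph t (i / 2)) : ℚ) =
          (5 * (n : ℚ) + 8 - (i : ℚ)) / 8) ∧
    ¬ ExtremalBrick.LucchesiMurtyConjecture := by
  refine ⟨fun n hn h18 => ?_, ExtremalBrick.not_lucchesiMurtyConjecture⟩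
  obtain ⟨t, i, ht, hi, hi8, hnt, hdeg, hV, hbrick, hE, hPM⟩ :=
    ExtremalBrick.exists_doublePrimeGraph hn h18
  have hPM' : (ExtremalBrick.numPM (ExtremalBrick.doublePrimeGraph t (i / 2)) : ℚ) =
      (5 * (n : ℚ) + 8 - (i : ℚ)) / 8 := by
    have : (8 * ExtremalBrick.numPM (ExtremalBrick.doublePrimeGraph t (i / 2)) + i : ℚ) =
        5 * n + 8 := by exact_mod_cast hPM
    linarith
  have hi' : (1 : ℚ) ≤ i := by exact_mod_cast hi
  have hi8' : (i : ℚ) ≤ 8 := by exact_mod_cast hi8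
  refine ⟨t, i, ht, hi, hi8, hnt, hdeg, hV, hbrick, by omega, ?_, hPM'⟩
  rw [eq_comm, Int.ceil_eq_iff, Int.cast_natCast, hPM']
  constructor <;> linarith
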